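/- Let $\mathfrak A=\overline{\bigotimes_{j\in\mathbb Z}M_2(\mathbb C)}^{\,C^*}$ be the UHF $C^*$-algebra of quasi-local observables of the spin-$\tfrac12$ chain on $\mathbb Z$, and for $Q\in M_2(\mathbb C)$ and $j\in\mathbb Z$ let $Q^{(j)}\in\mathfrak A$ be the element with $Q$ in the $j$-th tensor factor and $1$ in all the others. Let $\mathfrak A_R$ be the $C^*$-subalgebra of $\mathfrak A$ generated by all $Q^{(j)}$ with $j\ge 1$. Let $\tau_k$ ($k\in\mathbb Z$) be the automorphism of $\mathfrak A$ with $\tau_k(Q^{(j)})=Q^{(j+k)}$, and let $\gamma_\theta$ ($\theta\in\mathbb R$) be the automorphism of $\mathfrak A$ with $\gamma_\theta(Q^{(j)})=\bigl(e^{i\theta\sigma_z/2}\,Q\,e^{-i\theta\sigma_z/2}\bigr)^{(j)}$, where $\sigma_z=\mathrm{diag}(1,-1)$. Let $\varphi$ be a pure state of $\mathfrak A$ such that - $\varphi\circ\tau_k=\varphi$ for all $k\in\mathbb Z$ (translation invariance); - $\varphi\circ\gamma_\theta=\varphi$ for all $\theta\in\mathbb R$ ($U(1)$ gauge invariance); -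 the restriction $\varphi_R=\varphi|_{\mathfrak A_R}$ gives rise to a type I representation, i.e. the von Neumann algebra $\pi_{\varphi_R}(\mathfrak A_R)''$ generated by the GNS representation of $\varphi_R$ is of type I. Then $\varphi$ is a product state: for all $n\ge 0$, all pairwise distinct sites $j_1,\dots,j_n\in\mathbb Z$ and all $Q_1,\dots,Q_n\in M_2(\mathbb C)$, $$\varphi\bigl(Q_1^{(j_1)}\cdots Q_n^{(j_n)}\bigr)=\prod_{i=1}^n\varphi\bigl(Q_i^{(j_i)}\bigr).$$ -/

import Mathlib

open scoped ComplexOrder lp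

namespace SpinChain

/-! ### States, GNS representations and type I von Neumann algebras -/

section States

variable {A : Type*} [CStarAlgebra A]

/-- A state: a normalized positive linear functional on a unital C⋆-algebra. -/
structure State (A : Type*) [CStarAlgebra A] extends A →ₗ[ℂ] ℂ where
  nonneg : ∀ a : A, 0 ≤ toFun (star a * a)
  map_one : toFun 1 = 1

noncomputable instance : CoeFun (State A) (fun _ => A → ℂ) := ⟨fun φ => φ.toLinearMap⟩

/-- A pure state: an extreme point of the convex set of all states. -/
def State.IsPure (φ : State A) : Prop :=
  φ.toLinearMap ∈ Set.extremePoints ℝ (Set.range (State.toLinearMap (A := A)))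

/-- The restriction of a state to a C⋆-subalgebra. -/
noncomputable def State.restrict (φ : State A) (B : StarSubalgebra ℂ A) [IsClosed (B : Set A)] : State B where
  toLinearMap := φ.toLinearMap ∘ₗ B.subtype.toAlgHom.toLinearMap
  nonneg b := φ.nonneg (b : A)
  map_one := φ.map_one

section GNS

attribute [local instance] CStarAlgebra.spectralOrder CStarAlgebra.spectralOrderedRing

/-- A state as a positive linear map, where `A` carries its canonical order
(`a ≤ b` iff `b - a` is self-adjoint with nonnegative spectrum). -/
noncomputable def State.toPositiveLinearMap (φ : State A) : A →ₚ[ℂ] ℂ :=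
  PositiveLinearMap.mk₀ φ.toLinearMap (by
    intro a ha
    obtain ⟨b, rfl⟩ := CStarAlgebra.nonneg_iff_eq_star_mul_self.mp ha
    exact φ.nonneg b)

/-- The GNS Hilbert space of a state. -/
noncomputable abbrev State.GNSSpace (φ : State A) := φ.toPositiveLinearMap.GNS

/-- The GNS representation of a state. -/
noncomputable def State.gnsRep (φ : State A) :
    A →⋆ₐ[ℂ] (φ.GNSSpace →L[ℂ] φ.GNSSpace) :=
  φ.toPositiveLinearMap.gnsStarAlgHom

end GNS

section VonNeumann

variable {K : Type*} [NormedAddCommGroup K] [InnerProductSpace ℂ K] [CompleteSpace K]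

/-- The von Neumann algebra `S''` generated by a unital ⋆-algebra `S` of bounded operators. -/
noncomputable def bicommutant (S : StarSubalgebra ℂ (K →L[ℂ] K)) : VonNeumannAlgebra K where
  toStarSubalgebra :=
    StarSubalgebra.centralizer ℂ (StarSubalgebra.centralizer ℂ (S : Set (K →L[ℂ] K)))
  centralizer_centralizer' := by
    have h := StarSubalgebra.coe_centralizer_centralizer ℂ (S : Set (K →L[ℂ] K))
    change Set.centralizer (Set.centralizer (SetLike.coe (StarSubalgebra.centralizer ℂ
      (StarSubalgebra.centralizer ℂ (S : Set (K →L[ℂ] K)) : Set (K →L[ℂ] K))))) =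
      SetLike.coe (StarSubalgebra.centralizer ℂ
        (StarSubalgebra.centralizer ℂ (S : Set (K →L[ℂ] K)) : Set (K →L[ℂ] K)))
    rw [h, Set.centralizer_centralizer_centralizer]

/-- A von Neumann algebra `M` is of type I if every nonzero central projection `z` of `M`
dominates a nonzero abelian projection `e` of `M` (one for which `e M e` is commutative). -/
def IsTypeI (M : VonNeumannAlgebra K) : Prop :=
  ∀ z : K →L[ℂ] K, IsStarProjection z → z ∈ M → z ∈ M.commutant → z ≠ 0 →
    ∃ e : K →L[ℂ] K, IsStarProjection e ∧ e ∈ M ∧ e ≠ 0 ∧ z * e = e ∧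
      ∀ x ∈ M, ∀ y ∈ M, Commute (e * x * e) (e * y * e)

end VonNeumann

/-- The state gives rise to a type I representation: the von Neumann algebra `π_φ(A)''` generated
by its GNS representation is of type I. -/
def State.IsTypeIRep (φ : State A) : Prop :=
  IsTypeI (bicommutant φ.gnsRep.range)

end States

/-! ### The quasi-local algebra of the spin-1/2 chain

The C⋆-algebra `⨂_{ℤ} M₂(ℂ)` is realized on the incomplete infinite tensor product of copies of `ℂ²`
along the all-up vector, i.e. on `ℓ²` of the spin configurations with finitely many down spins.
The local matrix algebras act faithfully there, and the C⋆-norm of a full matrix algebra is unique,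
so the norm closure of the local algebra is the UHF algebra `2^∞`. -/

/-- Spin configurations on `ℤ` with finitely many down spins (`0` is up, `1` is down). -/
abbrev Config := ℤ →₀ Fin 2

/-- The Hilbert space with orthonormal basis the configurations. -/
noncomputable abbrev Space := ℓ²(Config, ℂ)

section Operators

theorem memlp_weighted (c : Config → ℂ) (hc : ∃ C : ℝ, ∀ s, ‖c s‖ ≤ C) (e : Equiv.Perm Config)
    (f : Space) : Memℓp (fun s => c s * f (e s)) 2 := by
  obtain ⟨C, hC⟩ := hc
  have hf : Summable fun s => ‖f s‖ ^ (2 : ENNReal).toReal := (lp.memℓp f).summable (by norm_num)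
  have hf' := ((e.summable_iff (f := fun s => ‖f s‖ ^ (2 : ENNReal).toReal)).mpr hf).mul_left (C ^ 2)
  refine memℓp_gen (Summable.of_nonneg_of_le (fun s => by positivity) (fun s => ?_) hf')
  simp only [ENNReal.toReal_ofNat, Real.rpow_ofNat, norm_mul, mul_pow, Function.comp_apply]
  gcongr
  exact hC s

/-- The bounded operator `f ↦ (s ↦ c s * f (e s))` for a bounded weight `c` and a permutation `e`
of the configurations. -/
noncomputable def weighted (c : Config → ℂ) (hc : ∃ C : ℝ, ∀ s, ‖c s‖ ≤ C)
    (e : Equiv.Perm Config) : Space →L[ℂ] Space :=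
  LinearMap.mkContinuousOfExistsBound
    { toFun := fun f => ⟨fun s => c s * f (e s), memlp_weighted c hc e f⟩
      map_add' := fun f g => by
        ext s
        exact mul_add _ _ _
      map_smul' := fun r f => by
        ext s
        simp [mul_left_comm] }
    (by
      obtain ⟨C, hC⟩ := hc
      refine ⟨C, fun f => ?_⟩
      have hC0 : 0 ≤ C := (norm_nonneg _).trans (hC 0)
      have h2 : 0 < (2 : ENNReal).toReal := by norm_num
      refine lp.norm_le_of_forall_sum_le h2 (by positivity) fun t => ?_
      have h := lp.sum_rpow_le_norm_rpow h2 f (t.map e.toEmbedding)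
      rw [Finset.sum_map] at h
      simp only [ENNReal.toReal_ofNat, Real.rpow_ofNat, mul_pow] at h ⊢
      calc _ ≤ ∑ s ∈ t, C ^ 2 * ‖f (e s)‖ ^ 2 := by
            refine Finset.sum_le_sum fun s _ => ?_
            simp only [LinearMap.coe_mk, AddHom.coe_mk, norm_mul, mul_pow]
            gcongr
            exact hC s
        _ ≤ _ := by
            rw [← Finset.mul_sum]
            gcongr
            exact h)

theorem weighted_apply (c : Config → ℂ) (hc : ∃ C : ℝ, ∀ s, ‖c s‖ ≤ C) (e : Equiv.Perm Config)
    (f : Space) (s : Config) : weighted c hc e f s = c s * f (e s) := rfl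

theorem star_weighted_apply (c : Config → ℂ) (hc : ∃ C : ℝ, ∀ s, ‖c s‖ ≤ C)
    (e : Equiv.Perm Config) (f : Space) (s : Config) :
    star (weighted c hc e) f s = star (c (e.symm s)) * f (e.symm s) := by
  have hc' : ∃ C : ℝ, ∀ s, ‖star (c (e.symm s))‖ ≤ C := by
    obtain ⟨C, hC⟩ := hc
    exact ⟨C, fun s => by simpa using hC (e.symm s)⟩
  have h : weighted (fun s => star (c (e.symm s))) hc' e.symm = star (weighted c hc e) := by
    rw [ContinuousLinearMap.star_eq_adjoint, ContinuousLinearMap.eq_adjoint_iff]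
    intro f g
    rw [lp.inner_eq_tsum, lp.inner_eq_tsum, ← e.tsum_eq]
    refine tsum_congr fun s => ?_
    simp [weighted_apply]
    ring
  rw [← h, weighted_apply]

/-- The operator `Q` acting on the spin at the site `j`, as an operator on `Space`. -/
noncomputable def siteOp (j : ℤ) (Q : Matrix (Fin 2) (Fin 2) ℂ) : Space →L[ℂ] Space :=
  ∑ b : Fin 2, weighted (fun s => Q (s j) (s j + b))
    ⟨∑ i, ∑ k, ‖Q i k‖, fun s =>
      (Finset.single_le_sum (f := fun k => ‖Q (s j) k‖) (fun _ _ => norm_nonneg _)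
        (Finset.mem_univ _)).trans
      (Finset.single_le_sum (f := fun i => ∑ k, ‖Q i k‖)
        (fun _ _ => Finset.sum_nonneg fun _ _ => norm_nonneg _) (Finset.mem_univ _))⟩
    (Equiv.addRight (Finsupp.single j b))

theorem add_single_eq_update (s : Config) (j : ℤ) (b : Fin 2) :
    s + Finsupp.single j b = s.update j (s j + b) := by
  ext i
  rcases eq_or_ne i j with rfl | h
  · simp
  · simp [h, Finsupp.update_apply]

/-- The matrix `Q` acts on the tensor factor at the site `j`. -/
theorem siteOp_apply (j : ℤ) (Q : Matrix (Fin 2) (Fin 2) ℂ) (f : Space) (s : Config) :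
    siteOp j Q f s = ∑ a : Fin 2, Q (s j) a * f (s.update j a) := by
  rw [siteOp, _root_.sum_apply, lp.coeFn_sum, Finset.sum_apply,
    ← Equiv.sum_comp (Equiv.addLeft (s j)) fun a => Q (s j) a * f (s.update j a)]
  refine Finset.sum_congr rfl fun b _ => ?_
  simp [weighted_apply, add_single_eq_update]

theorem siteOp_star (j : ℤ) (Q : Matrix (Fin 2) (Fin 2) ℂ) :
    siteOp j (star Q) = star (siteOp j Q) := by
  ext f s
  rw [siteOp_apply, siteOp, star_sum, _root_.sum_apply, lp.coeFn_sum,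
    Finset.sum_apply, ← (Equiv.subLeft (s j)).sum_comp]
  refine Finset.sum_congr rfl fun b _ => ?_
  have h : s - Finsupp.single j b = s.update j (s j - b) := by
    rw [sub_eq_add_neg, ← Finsupp.single_neg, add_single_eq_update, ← sub_eq_add_neg]
  rw [star_weighted_apply]
  simp [Matrix.star_apply, ← sub_eq_add_neg, h]

/-- The unital ⋆-homomorphism embedding `M₂(ℂ)` at the site `j`. -/
noncomputable def siteOpHom (j : ℤ) :
    Matrix (Fin 2) (Fin 2) ℂ →⋆ₐ[ℂ] (Space →L[ℂ] Space) :=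
  { AlgHom.ofLinearMap
      { toFun := siteOp j
        map_add' := fun Q R => by
          ext f s
          simp [siteOp_apply, add_mul]; ring
        map_smul' := fun r Q => by
          ext f s
          simp [siteOp_apply, mul_add, mul_assoc] }
      (by
        ext f s
        simp only [LinearMap.coe_mk, AddHom.coe_mk, siteOp_apply, Matrix.one_apply]
        simp)
      (fun Q R => by
        ext f s
        simp [siteOp_apply, Matrix.mul_apply]; ring) with
    map_star' := siteOp_star j }

/-- Observables at different sites commute. -/
theorem siteOp_commute {j k : ℤ} (h : j ≠ k) (Q R : Matrix (Fin 2) (Fin 2) ℂ) :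
    Commute (siteOp j Q) (siteOp k R) := by
  ext f s
  simp [siteOp_apply, Finsupp.update_apply, h, h.symm, Finsupp.update_comm s h]
  ring

/-- The quasi-local algebra of the spin-1/2 chain: the C⋆-algebra generated by all one-site
observables. -/
noncomputable def quasiLocal : StarSubalgebra ℂ (Space →L[ℂ] Space) :=
  (StarAlgebra.adjoin ℂ {T | ∃ j Q, T = siteOp j Q}).topologicalClosure

instance isClosed_quasiLocal : IsClosed (quasiLocal : Set (Space →L[ℂ] Space)) :=
  StarSubalgebra.isClosed_topologicalClosure _

theorem siteOp_mem (j : ℤ) (Q : Matrix (Fin 2) (Fin 2) ℂ) : siteOp j Q ∈ quasiLocal :=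
  StarSubalgebra.le_topologicalClosure _ (StarAlgebra.subset_adjoin ℂ _ ⟨j, Q, rfl⟩)

/-- The one-site observable `Q^{(j)}`, as a unital ⋆-homomorphism in `Q`. -/
noncomputable def site (j : ℤ) : Matrix (Fin 2) (Fin 2) ℂ →⋆ₐ[ℂ] quasiLocal :=
  (siteOpHom j).codRestrict quasiLocal (siteOp_mem j)

theorem coe_site (j : ℤ) (Q : Matrix (Fin 2) (Fin 2) ℂ) :
    (site j Q : Space →L[ℂ] Space) = siteOp j Q := rfl

/-- The C⋆-subalgebra of observables localized in `Λ`. -/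
noncomputable def localAlgebra (Λ : Set ℤ) : StarSubalgebra ℂ quasiLocal :=
  (StarAlgebra.adjoin ℂ {T | ∃ j ∈ Λ, ∃ Q, T = site j Q}).topologicalClosure

instance isClosed_localAlgebra (Λ : Set ℤ) : IsClosed (localAlgebra Λ : Set quasiLocal) :=
  StarSubalgebra.isClosed_topologicalClosure _

/-- The right half-chain algebra, localized in `[1, ∞)`. -/
noncomputable abbrev rightAlgebra : StarSubalgebra ℂ quasiLocal := localAlgebra (Set.Ici 1)

theorem conj_mem (U : unitary (Space →L[ℂ] Space))
    (hU : ∀ j Q, ∃ k R, (U : Space →L[ℂ] Space) * siteOp j Q = siteOp k R * U)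
    {T : Space →L[ℂ] Space} (hT : T ∈ quasiLocal) :
    Unitary.conjStarAlgAut ℂ (Space →L[ℂ] Space) U T ∈ quasiLocal := by
  let α := (Unitary.conjStarAlgAut ℂ (Space →L[ℂ] Space) U).toStarAlgHom
  have hα : Continuous α := by
    change Continuous fun T : Space →L[ℂ] Space =>
      (U : Space →L[ℂ] Space) * T * (star U : Space →L[ℂ] Space)
    fun_prop
  have hcl : IsClosed ((quasiLocal.comap α : StarSubalgebra ℂ (Space →L[ℂ] Space)) :
      Set (Space →L[ℂ] Space)) := isClosed_quasiLocal.preimage hα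
  have hle : quasiLocal ≤ quasiLocal.comap α := by
    refine StarSubalgebra.topologicalClosure_minimal (StarAlgebra.adjoin_le ?_) hcl
    rintro _ ⟨j, Q, rfl⟩
    obtain ⟨k, R, h⟩ := hU j Q
    change (U : Space →L[ℂ] Space) * siteOp j Q * (star U : Space →L[ℂ] Space) ∈ quasiLocal
    rw [h, mul_assoc, Unitary.mul_star_self_of_mem U.2, mul_one]
    exact siteOp_mem k R
  exact hle hT

/-- The automorphism of the quasi-local algebra implemented by a unitary that, together with its
inverse, maps one-site observables to one-site observables. -/
noncomputable def conjAut (U : unitary (Space →L[ℂ] Space))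
    (hU : ∀ j Q, ∃ k R, (U : Space →L[ℂ] Space) * siteOp j Q = siteOp k R * U)
    (hU' : ∀ j Q, ∃ k R, ((star U : unitary (Space →L[ℂ] Space)) : Space →L[ℂ] Space) * siteOp j Q
      = siteOp k R * (star U : unitary (Space →L[ℂ] Space))) :
    quasiLocal ≃⋆ₐ[ℂ] quasiLocal :=
  StarAlgEquiv.ofStarAlgHom
    ((((Unitary.conjStarAlgAut ℂ (Space →L[ℂ] Space) U).toStarAlgHom).comp
      quasiLocal.subtype).codRestrict quasiLocal fun T => conj_mem U hU T.2)
    ((((Unitary.conjStarAlgAut ℂ (Space →L[ℂ] Space) (star U)).toStarAlgHom).comp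
      quasiLocal.subtype).codRestrict quasiLocal fun T => conj_mem (star U) hU' T.2)
    (by
      ext1 T
      apply Subtype.ext
      change Unitary.conjStarAlgAut ℂ (Space →L[ℂ] Space) (star U)
        (Unitary.conjStarAlgAut ℂ (Space →L[ℂ] Space) U T) = T
      rw [← Unitary.conjStarAlgAut_symm, StarAlgEquiv.symm_apply_apply])
    (by
      ext1 T
      apply Subtype.ext
      change Unitary.conjStarAlgAut ℂ (Space →L[ℂ] Space) U
        (Unitary.conjStarAlgAut ℂ (Space →L[ℂ] Space) (star U) T) = T
      rw [← Unitary.conjStarAlgAut_symm, StarAlgEquiv.apply_symm_apply])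

theorem conjAut_site (U : unitary (Space →L[ℂ] Space)) (hU) (hU') {j k : ℤ}
    {Q R : Matrix (Fin 2) (Fin 2) ℂ}
    (h : (U : Space →L[ℂ] Space) * siteOp j Q = siteOp k R * U) :
    conjAut U hU hU' (site j Q) = site k R := by
  apply Subtype.ext
  change (U : Space →L[ℂ] Space) * siteOp j Q * (star U : Space →L[ℂ] Space) = siteOp k R
  rw [h, mul_assoc, Unitary.mul_star_self_of_mem U.2, mul_one]

/-- A weighted permutation operator with weights of modulus one is unitary. -/
noncomputable def weightedUnitary (c : Config → ℂ) (hc : ∀ s, ‖c s‖ = 1)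
    (e : Equiv.Perm Config) : unitary (Space →L[ℂ] Space) :=
  ⟨weighted c ⟨1, fun s => (hc s).le⟩ e, by
    rw [Unitary.mem_iff]
    constructor
    · ext f s
      have h := RCLike.conj_mul (c (e.symm s))
      rw [hc] at h
      simp [star_weighted_apply, weighted_apply, ← mul_assoc, h]
    · ext f s
      have h := RCLike.mul_conj (c s)
      rw [hc] at h
      simp [star_weighted_apply, weighted_apply, ← mul_assoc, h]⟩

/-- The configuration `s` shifted by `k`: the spin at `i` becomes `s (i + k)`. -/
def shiftConfig (k : ℤ) : Equiv.Perm Config :=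
  Finsupp.equivCongrLeft (Equiv.subRight k)

theorem shiftConfig_apply (k : ℤ) (s : Config) (i : ℤ) : shiftConfig k s i = s (i + k) := by
  simp [shiftConfig]

/-- The unitary shift on `Space`. -/
noncomputable def shiftUnitary (k : ℤ) : unitary (Space →L[ℂ] Space) :=
  weightedUnitary (fun _ => 1) (fun _ => by simp) (shiftConfig k)

theorem shiftUnitary_mul_siteOp (k j : ℤ) (Q : Matrix (Fin 2) (Fin 2) ℂ) :
    (shiftUnitary k : Space →L[ℂ] Space) * siteOp j Q
      = siteOp (k + j) Q * shiftUnitary k := by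
  ext f s
  have h (a : Fin 2) : (shiftConfig k s).update j a = shiftConfig k (s.update (k + j) a) := by
    ext i
    simp only [Finsupp.update_apply, shiftConfig_apply]
    grind
  simp [shiftUnitary, weightedUnitary, siteOp_apply, weighted_apply,
    h, shiftConfig_apply, add_comm j k]

theorem star_shiftUnitary (k : ℤ) : star (shiftUnitary k) = shiftUnitary (-k) := by
  apply Subtype.ext
  ext f s
  have h : (shiftConfig k).symm s = shiftConfig (-k) s := by
    rw [Equiv.symm_apply_eq]
    ext i
    simp [shiftConfig_apply]
  simp [shiftUnitary, weightedUnitary, star_weighted_apply, weighted_apply, h]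

/-- The lattice translation `τ_k`. -/
noncomputable def translation (k : ℤ) : quasiLocal ≃⋆ₐ[ℂ] quasiLocal :=
  conjAut (shiftUnitary k) (fun j Q => ⟨_, _, shiftUnitary_mul_siteOp k j Q⟩)
    (fun j Q => ⟨_, _, by rw [star_shiftUnitary]; exact shiftUnitary_mul_siteOp (-k) j Q⟩)

theorem translation_site (k j : ℤ) (Q : Matrix (Fin 2) (Fin 2) ℂ) :
    translation k (site j Q) = site (k + j) Q :=
  conjAut_site _ _ _ (shiftUnitary_mul_siteOp k j Q)

/-- The one-site rotation `exp (i θ σ_z / 2)`, with `σ_z = diag (1, -1)`. -/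
noncomputable def rotZ (θ : ℝ) : Matrix (Fin 2) (Fin 2) ℂ :=
  Matrix.diagonal ![Complex.exp (Complex.I * θ / 2), Complex.exp (-(Complex.I * θ / 2))]

/-- The unitary `exp (i θ ∑_j (σ_z^{(j)} - 1) / 2)` on `Space`: each down spin contributes the
phase `exp (-i θ)`. Subtracting the constant does not change the adjoint action. -/
noncomputable def gaugeUnitary (θ : ℝ) : unitary (Space →L[ℂ] Space) :=
  weightedUnitary
    (fun s => Complex.exp (((-θ * (s.sum fun _ a => (a : ℕ)) : ℝ) : ℂ) * Complex.I))
    (fun _ => Complex.norm_exp_ofReal_mul_I _) (Equiv.refl _)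

theorem gaugeUnitary_mul_siteOp (θ : ℝ) (j : ℤ) (Q : Matrix (Fin 2) (Fin 2) ℂ) :
    (gaugeUnitary θ : Space →L[ℂ] Space) * siteOp j Q
      = siteOp j (rotZ θ * Q * rotZ (-θ)) * gaugeUnitary θ := by
  ext f s
  have hN (t : Config) : (t.sum fun _ a => (a : ℕ)) =
      (t j : ℕ) + (t.erase j).sum fun _ a => (a : ℕ) :=
    (Finsupp.add_sum_erase' t j (fun _ a => (a : ℕ)) (fun _ => rfl)).symm
  have hupd (a : Fin 2) : ((s.update j a).sum fun _ a => (a : ℕ)) =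
      (a : ℕ) + (s.erase j).sum fun _ a => (a : ℕ) := by
    rw [hN (s.update j a), Finsupp.erase_update_eq_erase]
    simp
  simp only [gaugeUnitary, weightedUnitary, mul_apply_eq_comp, siteOp_apply, weighted_apply,
    Equiv.refl_apply, hupd, hN s, Finset.mul_sum]
  generalize ((s.erase j).sum fun _ a => (a : ℕ)) = N
  refine Finset.sum_congr rfl fun a _ => ?_
  simp only [← mul_assoc]
  congr 1
  generalize s j = b
  simp only [rotZ, Matrix.mul_diagonal, Matrix.diagonal_mul]
  rw [mul_comm, mul_right_comm _ (Q b a), mul_right_comm _ (Q b a), mul_comm _ (Q b a)]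
  congr 1
  fin_cases a <;> fin_cases b <;>
    · simp [← Complex.exp_add]
      try ring_nf

theorem star_gaugeUnitary (θ : ℝ) : star (gaugeUnitary θ) = gaugeUnitary (-θ) := by
  apply Subtype.ext
  ext f s
  simp [gaugeUnitary, weightedUnitary, star_weighted_apply, weighted_apply, ← Complex.exp_conj]

/-- The gauge action `γ_θ = Ad (exp (i θ S_z))`, `S_z = ½ ∑_j σ_z^{(j)}`. -/
noncomputable def gauge (θ : ℝ) : quasiLocal ≃⋆ₐ[ℂ] quasiLocal :=
  conjAut (gaugeUnitary θ) (fun j Q => ⟨_, _, gaugeUnitary_mul_siteOp θ j Q⟩)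
    (fun j Q => ⟨_, _, by rw [star_gaugeUnitary]; exact gaugeUnitary_mul_siteOp (-θ) j Q⟩)

theorem gauge_site (θ : ℝ) (j : ℤ) (Q : Matrix (Fin 2) (Fin 2) ℂ) :
    gauge θ (site j Q) = site j (rotZ θ * Q * rotZ (-θ)) :=
  conjAut_site _ _ _ (gaugeUnitary_mul_siteOp θ j Q)

end Operators

/-- A product state: `φ (Q₁^{(j₁)} ⋯ Qₙ^{(jₙ)}) = φ (Q₁^{(j₁)}) ⋯ φ (Qₙ^{(jₙ)})` for distinct sites
`j₁, …, jₙ`. -/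
def IsProductState (φ : State quasiLocal) : Prop :=
  ∀ (l : List ℤ) (Q : ℤ → Matrix (Fin 2) (Fin 2) ℂ), l.Nodup →
    φ (l.map fun j => site j (Q j)).prod = (l.map fun j => φ (site j (Q j))).prod

end SpinChain

/-!
The GNS representation of a pure state is irreducible. By the type I hypothesis the von Neumann
algebra of the right half-chain has a minimal projection, and comparing it with its image under
the gauge group shows that the rotations of the half-chain `[1, ∞)` are implemented, for small
`θ`, by unitaries `U_θ` with `U_θ → 1` strongly as `θ → 0`. With `T` the unitary implementing the
translation by one site, `T U_θ T*` rotates `[2, ∞)`, so that by irreducibility `U_θ = χ(θ) v_θ T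
U_θ T*`, where `v_θ` multiplies a down spin at the site `1` by `e^{-iθ}`. The scalar `χ` is a
continuous character of the circle, hence `χ(θ) = e^{imθ}` with `m` an integer. Applying the
relation `n` times to the cyclic vector `Ω` gives `|χ(θ)^n φ(v_θ^{(1)} ⋯ v_θ^{(n)}) - 1| ≤ 2 ‖U_θ
Ω - Ω‖` for every `n`. Thus, with `N_n` the number of down spins at the sites `1, …, n`, the
characteristic functions of `N_n - mn` are close to `1` near `0`, uniformly in `n`, which is
incompatible with a mean growing linearly in `n`: the density of down spins is `m`. Being a
probability it is `0` or `1`, so all spins are up or all are down, and `φ` is a product state.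
-/

namespace SpinChain

open Filter Topology MeasureTheory

open scoped CStarAlgebra

section Representations

variable {G ι : Type*} {H K : Type*}
  [NormedAddCommGroup H] [InnerProductSpace ℂ H] [NormedAddCommGroup K] [InnerProductSpace ℂ K]

/-- The vectors `v i` generate a dense subspace under the operators `π g`. -/
def IsCyclicFamily (π : G → H →L[ℂ] H) (v : ι → H) : Prop :=
  Dense (Submodule.span ℂ (Set.range fun p : G × ι => π p.1 (v p.2)) : Set H)

/-- A family of operators is irreducible if its commutant consists of the scalars. -/
def IsIrreducible (π : G → H →L[ℂ] H) : Prop :=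
  ∀ T : H →L[ℂ] H, (∀ g, Commute T (π g)) → ∃ c : ℂ, T = c • 1

theorem IsCyclicFamily.ext {π : G → H →L[ℂ] H} {v : ι → H} (hv : IsCyclicFamily π v)
    {S T : H →L[ℂ] K} (h : ∀ g i, S (π g (v i)) = T (π g (v i))) : S = T :=
  ContinuousLinearMap.ext_on hv <| by
    rintro _ ⟨p, rfl⟩
    exact h p.1 p.2

theorem IsCyclicFamily.comp_surjective {π : G → H →L[ℂ] H} {v : ι → H} (hv : IsCyclicFamily π v)
    {σ : G → G} (hσ : Function.Surjective σ) : IsCyclicFamily (π ∘ σ) v := by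
  refine hv.mono (Submodule.span_mono ?_)
  rintro _ ⟨⟨g, i⟩, rfl⟩
  obtain ⟨g, rfl⟩ := hσ g
  exact ⟨(g, i), rfl⟩

theorem inner_linearCombination_eq {x : ι → H} {y : ι → K}
    (h : ∀ i j, inner ℂ (y i) (y j) = inner ℂ (x i) (x j)) (a b : ι →₀ ℂ) :
    inner ℂ (Finsupp.linearCombination ℂ y a) (Finsupp.linearCombination ℂ y b) =
      inner ℂ (Finsupp.linearCombination ℂ x a) (Finsupp.linearCombination ℂ x b) := by
  simp only [Finsupp.linearCombination_apply, Finsupp.sum, sum_inner, inner_sum, inner_smul_left,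
    inner_smul_right, h]

theorem exists_linearIsometry_of_inner_eq [CompleteSpace K] {x : ι → H} {y : ι → K}
    (hx : Dense (Submodule.span ℂ (Set.range x) : Set H))
    (h : ∀ i j, inner ℂ (y i) (y j) = inner ℂ (x i) (x j)) :
    ∃ J : H →ₗᵢ[ℂ] K, ∀ i, J (x i) = y i := by
  let F := Finsupp.linearCombination ℂ x
  let F' := Finsupp.linearCombination ℂ y
  have hdense : DenseRange F := by
    rwa [← Finsupp.range_linearCombination] at hx
  have hnorm (a : ι →₀ ℂ) : ‖F' a‖ = ‖F a‖ := by
    rw [@norm_eq_sqrt_re_inner ℂ, @norm_eq_sqrt_re_inner ℂ, inner_linearCombination_eq h]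
  have hext (a : ι →₀ ℂ) : F'.extendOfNorm F (F a) = F' a :=
    LinearMap.extendOfNorm_eq hdense ⟨1, fun b => by rw [one_mul, hnorm]⟩ a
  refine ⟨⟨(F'.extendOfNorm F).toLinearMap, fun z => ?_⟩, fun i => ?_⟩
  · exact hdense.induction_on (p := fun z => ‖F'.extendOfNorm F z‖ = ‖z‖) z
      (isClosed_eq (by fun_prop) (by fun_prop)) fun a => by rw [hext, hnorm]
  · simpa [F, F'] using hext (Finsupp.single i 1)

variable [CompleteSpace H]

/-- The unitary `U` implements the substitution `σ` of the index set of the family `π`. -/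
structure Implements (π : G → H →L[ℂ] H) (σ : G → G) (U : H →L[ℂ] H) : Prop where
  mem_unitary : U ∈ unitary (H →L[ℂ] H)
  mul_apply : ∀ g, U * π g = π (σ g) * U

section Star

variable [Monoid G] [StarMul G]

theorem inner_map_apply_map_apply (π : G →⋆* (H →L[ℂ] H)) (g h : G) (x y : H) :
    inner ℂ (π g x) (π h y) = inner ℂ x (π (star g * h) y) := by
  rw [map_mul, map_star, ContinuousLinearMap.star_eq_adjoint, mul_apply_eq_comp,
    ContinuousLinearMap.adjoint_inner_right]

theorem IsCyclicFamily.exists_linearIsometry [CompleteSpace K] {π₁ : G →⋆* (H →L[ℂ] H)}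
    {π₂ : G →⋆* (K →L[ℂ] K)} {v : ι → H} {w : ι → K} (hv : IsCyclicFamily π₁ v)
    (h : ∀ g i j, inner ℂ (w i) (π₂ g (w j)) = inner ℂ (v i) (π₁ g (v j))) :
    ∃ J : H →ₗᵢ[ℂ] K, (∀ i, J (v i) = w i) ∧ ∀ g x, J (π₁ g x) = π₂ g (J x) := by
  obtain ⟨J, hJ⟩ := exists_linearIsometry_of_inner_eq
    (y := fun p : G × ι => π₂ p.1 (w p.2)) hv fun p q => by
      simp only [inner_map_apply_map_apply, h]
  have hJ (g : G) (i : ι) : J (π₁ g (v i)) = π₂ g (w i) := hJ (g, i)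
  refine ⟨J, fun i => by simpa using hJ 1 i, fun g => DFunLike.congr_fun (?_ :
    J.toContinuousLinearMap ∘L π₁ g = π₂ g ∘L J.toContinuousLinearMap)⟩
  refine hv.ext fun k i => ?_
  have hk : J (π₁ g (π₁ k (v i))) = π₂ (g * k) (w i) := by
    rw [← hJ, map_mul, mul_apply_eq_comp]
  simpa [hJ] using hk

theorem IsCyclicFamily.exists_implements {π : G →⋆* (H →L[ℂ] H)} {v w : ι → H} {σ : G →⋆* G}
    (hv : IsCyclicFamily π v) (hw : IsCyclicFamily (π ∘ σ) w)
    (h : ∀ g i j, inner ℂ (w i) (π (σ g) (w j)) = inner ℂ (v i) (π g (v j))) :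
    ∃ U, Implements π σ U ∧ ∀ i, U (v i) = w i := by
  obtain ⟨J, hJv, hJ⟩ := hv.exists_linearIsometry (π₂ := π.comp σ) h
  have hrange : Submodule.span ℂ (Set.range fun p : G × ι => π (σ p.1) (w p.2)) ≤
      LinearMap.range J.toLinearMap := by
    rw [Submodule.span_le]
    rintro _ ⟨⟨g, i⟩, rfl⟩
    exact ⟨π g (v i), (hJ g (v i)).trans (by rw [hJv]; rfl)⟩
  have hsurj : Function.Surjective J := by
    rw [← Set.range_eq_univ, ← J.isometry.isClosedEmbedding.isClosed_range.closure_eq]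
    exact (hw.mono hrange).closure_eq
  let U := Unitary.linearIsometryEquiv.symm (LinearIsometryEquiv.ofSurjective J hsurj)
  exact ⟨U, ⟨U.2, fun g => ContinuousLinearMap.ext (hJ g)⟩, hJv⟩

theorem IsIrreducible.isCyclicFamily {π : G →⋆* (H →L[ℂ] H)} (hπ : IsIrreducible π) {v : ι → H}
    {i : ι} (hvi : v i ≠ 0) : IsCyclicFamily π v := by
  let E := (Submodule.span ℂ (Set.range fun p : G × ι => π p.1 (v p.2))).topologicalClosure
  have : CompleteSpace E := (Submodule.isClosed_topologicalClosure _).completeSpace_coe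
  have hspan (g : G) (x) (hx : x ∈ Submodule.span ℂ (Set.range fun p : G × ι => π p.1 (v p.2))) :
      π g x ∈ Submodule.span ℂ (Set.range fun p : G × ι => π p.1 (v p.2)) := by
    induction hx using Submodule.span_induction with
    | mem x hx =>
      obtain ⟨⟨k, j⟩, rfl⟩ := hx
      exact Submodule.subset_span ⟨(g * k, j), by simp⟩
    | zero => simp
    | add x y _ _ hx hy => simpa using add_mem hx hy
    | smul c x _ hx => simpa using Submodule.smul_mem _ c hx
  have hE (g : G) (x) (hx : x ∈ E) : π g x ∈ E :=
    map_mem_closure (π g).continuous hx (hspan g)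
  have hinv (g : G) : E.starProjection * (π g * E.starProjection) = π g * E.starProjection := by
    ext x
    exact Submodule.starProjection_eq_self_iff.mpr (hE g _ (E.starProjection_apply_mem x))
  have hcomm (g : G) : Commute E.starProjection (π g) := by
    have h := congrArg star (hinv (star g))
    simp only [star_mul, map_star, star_star, (isSelfAdjoint_starProjection E).star_eq] at h
    rw [Commute, SemiconjBy, ← hinv, ← mul_assoc, h]
  obtain ⟨c, hc⟩ := hπ _ hcomm
  have hvE : v i ∈ E := subset_closure (Submodule.subset_span ⟨(1, i), by simp⟩)
  have hcv : c • v i = v i := by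
    simpa [hc] using Submodule.starProjection_eq_self_iff.mpr hvE
  have hc1 : c = 1 := smul_left_injective ℂ hvi (by simpa using hcv)
  intro x
  change x ∈ E
  rw [← Submodule.starProjection_eq_self_iff, hc, hc1]
  simp

end Star

theorem implements_id_one (π : G → H →L[ℂ] H) : Implements π id 1 :=
  ⟨one_mem _, fun g => by rw [one_mul, mul_one, id]⟩

theorem Implements.mul {π : G → H →L[ℂ] H} {σ τ : G → G} {U V : H →L[ℂ] H}
    (hU : Implements π σ U) (hV : Implements π τ V) : Implements π (σ ∘ τ) (U * V) :=
  ⟨mul_mem hU.1 hV.1, fun g => by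
    rw [mul_assoc, hV.2, ← mul_assoc, hU.2, mul_assoc, Function.comp_apply]⟩

theorem Implements.pow {π : G → H →L[ℂ] H} {σ : G → G} {U : H →L[ℂ] H}
    (hU : Implements π σ U) (n : ℕ) : Implements π σ^[n] (U ^ n) := by
  induction n with
  | zero => exact implements_id_one π
  | succ n ih => simpa only [pow_succ, Function.iterate_succ] using ih.mul hU

theorem Implements.star_mul_apply {π : G → H →L[ℂ] H} {σ : G → G} {U : H →L[ℂ] H}
    (hU : Implements π σ U) (g : G) : star U * π (σ g) = π g * star U := by
  have h := congrArg (fun T => star U * T * star U) (hU.2 g)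
  simpa only [mul_assoc, Unitary.mul_star_self_of_mem hU.1, mul_one, ← mul_assoc (star U) U,
    Unitary.star_mul_self_of_mem hU.1, one_mul] using h.symm

theorem Implements.inv {π : G → H →L[ℂ] H} {σ τ : G → G} {U : H →L[ℂ] H}
    (hU : Implements π σ U) (h : Function.RightInverse τ σ) : Implements π τ (star U) :=
  ⟨Unitary.star_mem hU.1, fun g => by simpa only [h g] using hU.star_mul_apply (τ g)⟩

theorem Implements.eq_smul {π : G → H →L[ℂ] H} (hπ : IsIrreducible π) {σ : G → G}
    {U V : H →L[ℂ] H} (hU : Implements π σ U) (hV : Implements π σ V) : ∃ c : ℂ, U = c • V := by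
  obtain ⟨c, hc⟩ := hπ (star V * U) fun g => by
    rw [Commute, SemiconjBy, mul_assoc, hU.2, ← mul_assoc, hV.star_mul_apply, mul_assoc]
  refine ⟨c, ?_⟩
  calc U = V * (star V * U) := by rw [← mul_assoc, Unitary.mul_star_self_of_mem hV.1, one_mul]
    _ = c • V := by rw [hc, mul_smul_comm, mul_one]

theorem isClosed_setOf_tendsto_self {α X : Type*} [PseudoMetricSpace X] {F : α → X → X}
    (hF : ∀ a, LipschitzWith 1 (F a)) (l : Filter α) :
    IsClosed {x | Tendsto (F · x) l (𝓝 x)} :=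
  (LipschitzWith.uniformEquicontinuous F 1 hF).equicontinuous.isClosed_setOfPred_tendsto
    continuous_id

theorem IsCyclicFamily.tendsto_of_implements {α : Type*} {l : Filter α} {π : G → H →L[ℂ] H}
    {v : ι → H} (hv : IsCyclicFamily π v) {U : α → H →L[ℂ] H}
    (hU : ∀ a, U a ∈ unitary (H →L[ℂ] H)) {σ : α → G → G}
    (hUσ : ∀ᶠ a in l, Implements π (σ a) (U a))
    (hσ : ∀ g, Tendsto (fun a => π (σ a g)) l (𝓝 (π g)))
    (hUv : ∀ i, Tendsto (fun a => U a (v i)) l (𝓝 (v i))) (x : H) :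
    Tendsto (fun a => U a x) l (𝓝 x) := by
  have hclosed : IsClosed {x | Tendsto (fun a => U a x) l (𝓝 x)} :=
    isClosed_setOf_tendsto_self (fun a => LipschitzWith.of_dist_le_mul fun x y => by
      simp [dist_eq_norm, ← map_sub, Unitary.norm_map (⟨U a, hU a⟩ : unitary (H →L[ℂ] H))]) l
  refine (hclosed.closure_subset_iff.mpr fun y hy => ?_) (hv x)
  induction hy using Submodule.span_induction with
  | mem y hy =>
    obtain ⟨⟨g, i⟩, rfl⟩ := hy
    have hlim : Tendsto (fun a => π (σ a g) (U a (v i))) l (𝓝 (π g (v i))) :=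
      ((by fun_prop : Continuous fun p : (H →L[ℂ] H) × H => p.1 p.2).tendsto _).comp
        ((hσ g).prodMk_nhds (hUv i))
    refine hlim.congr' ?_
    filter_upwards [hUσ] with a ha using (DFunLike.congr_fun (ha.2 g) (v i)).symm
  | zero => simpa using tendsto_const_nhds
  | add y z _ _ hy hz => simpa using hy.add hz
  | smul c y _ hy => simpa using hy.const_smul c

end Representations

section GNS

variable {A : Type*} [CStarAlgebra A]

section CyclicVector

attribute [local instance] CStarAlgebra.spectralOrder CStarAlgebra.spectralOrderedRing

/-- The cyclic vector of the GNS representation. -/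
noncomputable def State.cyclicVector (φ : State A) : φ.GNSSpace :=
  ((φ.toPositiveLinearMap.toPreGNS 1 : φ.toPositiveLinearMap.PreGNS) : φ.GNSSpace)

theorem State.gnsRep_cyclicVector (φ : State A) (a : A) :
    φ.gnsRep a φ.cyclicVector =
      ((φ.toPositiveLinearMap.toPreGNS a : φ.toPositiveLinearMap.PreGNS) : φ.GNSSpace) := by
  refine (PositiveLinearMap.gnsNonUnitalStarAlgHom_apply_coe ..).trans ?_
  simp

theorem State.inner_cyclicVector_gnsRep (φ : State A) (a : A) :
    inner ℂ φ.cyclicVector (φ.gnsRep a φ.cyclicVector) = φ a := by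
  rw [φ.gnsRep_cyclicVector, State.cyclicVector, UniformSpace.Completion.inner_coe]
  change φ (star 1 * a) = φ a
  rw [star_one, one_mul]

theorem State.isCyclicFamily_gnsRep (φ : State A) :
    IsCyclicFamily φ.gnsRep fun _ : Unit => φ.cyclicVector := by
  have hrange : Set.range ((↑) : φ.toPositiveLinearMap.PreGNS → φ.GNSSpace) ⊆
      Set.range fun p : A × Unit => φ.gnsRep p.1 φ.cyclicVector := by
    rintro _ ⟨x, rfl⟩
    exact ⟨(φ.toPositiveLinearMap.toPreGNS.symm x, ()), by simp [φ.gnsRep_cyclicVector]⟩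
  exact UniformSpace.Completion.denseRange_coe.mono (hrange.trans Submodule.subset_span)

end CyclicVector

theorem State.norm_cyclicVector (φ : State A) : ‖φ.cyclicVector‖ = 1 := by
  have h : inner ℂ φ.cyclicVector φ.cyclicVector = 1 := by
    simpa using (φ.inner_cyclicVector_gnsRep 1).trans φ.map_one
  rw [@norm_eq_sqrt_re_inner ℂ, h, RCLike.one_re, Real.sqrt_one]

theorem State.nontrivial_gnsSpace (φ : State A) : Nontrivial φ.GNSSpace :=
  nontrivial_of_ne φ.cyclicVector 0 (norm_ne_zero_iff.mp (by simp [φ.norm_cyclicVector]))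

theorem State.exists_implements_of_invariant (φ : State A) (σ : A ≃⋆ₐ[ℂ] A)
    (hσ : ∀ a, φ (σ a) = φ a) :
    ∃ T, Implements φ.gnsRep σ T ∧ T φ.cyclicVector = φ.cyclicVector := by
  obtain ⟨T, hT, hfix⟩ := IsCyclicFamily.exists_implements (π := .ofClass φ.gnsRep)
    (σ := .ofClass σ) φ.isCyclicFamily_gnsRep
    (φ.isCyclicFamily_gnsRep.comp_surjective σ.surjective) fun a _ _ =>
      ((φ.inner_cyclicVector_gnsRep (σ a)).trans (hσ a)).trans
        (φ.inner_cyclicVector_gnsRep a).symm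
  exact ⟨T, hT, hfix ()⟩

theorem State.exists_linearIsometry_restrict (φ : State A) (B : StarSubalgebra ℂ A)
    [IsClosed (B : Set A)] :
    ∃ J : (φ.restrict B).GNSSpace →ₗᵢ[ℂ] φ.GNSSpace,
      ∀ b k, J ((φ.restrict B).gnsRep b k) = φ.gnsRep b (J k) := by
  obtain ⟨J, -, hJ⟩ := IsCyclicFamily.exists_linearIsometry
    (π₁ := .ofClass (φ.restrict B).gnsRep) (π₂ := .ofClass (φ.gnsRep.comp B.subtype))
    (w := fun _ => φ.cyclicVector) (φ.restrict B).isCyclicFamily_gnsRep fun b _ _ =>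
      (φ.inner_cyclicVector_gnsRep b).trans ((φ.restrict B).inner_cyclicVector_gnsRep b).symm
  exact ⟨J, hJ⟩

variable {H : Type*} [NormedAddCommGroup H] [InnerProductSpace ℂ H] [CompleteSpace H]

/-- The vector state of a unit vector in a representation. -/
noncomputable def State.ofVector (π : A →⋆ₐ[ℂ] (H →L[ℂ] H)) (x : H) (hx : ‖x‖ = 1) :
    State A where
  toFun a := inner ℂ x (π a x)
  map_add' a b := by simp
  map_smul' c a := by simp
  nonneg a := by
    have h : inner ℂ x (π (star a * a) x) = (‖π a x‖ : ℂ) ^ 2 :=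
      (inner_map_apply_map_apply (.ofClass π) a a x x).symm.trans (inner_self_eq_norm_sq_to_K _)
    change 0 ≤ inner ℂ x (π (star a * a) x)
    rw [h]
    positivity
  map_one := by simp [inner_self_eq_norm_sq_to_K, hx]

theorem exists_eq_norm_sq_mul_state (π : A →⋆ₐ[ℂ] (H →L[ℂ] H)) {x : H} (hx : x ≠ 0) :
    ∃ ψ : State A, ∀ a, inner ℂ x (π a x) = (‖x‖ : ℂ) ^ 2 * ψ a := by
  refine ⟨.ofVector π ((‖x‖⁻¹ : ℂ) • x) (by simp [norm_smul, hx]), fun a => ?_⟩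
  change _ = _ * inner ℂ ((‖x‖⁻¹ : ℂ) • x) (π a ((‖x‖⁻¹ : ℂ) • x))
  have : (‖x‖ : ℂ) ≠ 0 := by simpa using hx
  simp only [map_smul, inner_smul_left, inner_smul_right, map_inv₀, Complex.conj_ofReal]
  field_simp

theorem State.IsPure.inner_eq_of_add {φ : State A} (hφ : φ.IsPure) (π : A →⋆ₐ[ℂ] (H →L[ℂ] H))
    {x y : H} (hxy : ∀ a, φ a = inner ℂ x (π a x) + inner ℂ y (π a y)) (a : A) :
    inner ℂ x (π a x) = (‖x‖ : ℂ) ^ 2 * φ a := by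
  have hnorm : ‖x‖ ^ 2 + ‖y‖ ^ 2 = 1 := by
    have h := (hxy 1).symm.trans φ.map_one
    simp only [_root_.map_one, one_apply_eq_self, inner_self_eq_norm_sq_to_K] at h
    exact Complex.ofReal_injective (by simpa using h)
  rcases eq_or_ne x 0 with rfl | hx
  · simp
  rcases eq_or_ne y 0 with rfl | hy
  · have hx1 : ‖x‖ = 1 := (pow_eq_one_iff_of_nonneg (norm_nonneg x) two_ne_zero).mp
      (by simpa using hnorm)
    simp [hxy a, hx1]
  obtain ⟨ψ, hψ⟩ := exists_eq_norm_sq_mul_state π hx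
  obtain ⟨χ, hχ⟩ := exists_eq_norm_sq_mul_state π hy
  have hψφ : ψ.toLinearMap = φ.toLinearMap := by
    refine ((mem_extremePoints.mp hφ).2 _ ⟨ψ, rfl⟩ _ ⟨χ, rfl⟩
      ⟨‖x‖ ^ 2, ‖y‖ ^ 2, by positivity, by positivity, hnorm, LinearMap.ext fun b => ?_⟩).1
    simp [hxy b, hψ, hχ]
  rw [hψ, hψφ]

theorem State.IsPure.star_mul_self_eq_smul {φ : State A} (hφ : φ.IsPure)
    {b c : φ.GNSSpace →L[ℂ] φ.GNSSpace} (hb : ∀ a, Commute b (φ.gnsRep a))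
    (hc : ∀ a, Commute c (φ.gnsRep a)) (hbc : star b * b + star c * c = 1) :
    ∃ r : ℂ, star b * b = r • 1 := by
  let Ω := φ.cyclicVector
  have hinner {d : φ.GNSSpace →L[ℂ] φ.GNSSpace} (hd : ∀ a, Commute d (φ.gnsRep a)) (a : A) :
      inner ℂ (d Ω) (φ.gnsRep a (d Ω)) = inner ℂ ((star d * d) Ω) (φ.gnsRep a Ω) := by
    rw [ContinuousLinearMap.star_eq_adjoint, mul_apply_eq_comp,
      ContinuousLinearMap.adjoint_inner_left]
    exact congrArg (inner ℂ (d Ω)) (DFunLike.congr_fun (hd a).eq Ω).symm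
  have hsum (a : A) :
      φ a = inner ℂ (b Ω) (φ.gnsRep a (b Ω)) + inner ℂ (c Ω) (φ.gnsRep a (c Ω)) := by
    rw [hinner hb, hinner hc, ← inner_add_left, ← add_apply, hbc, one_apply_eq_self,
      φ.inner_cyclicVector_gnsRep]
  have hfunctional : innerSL ℂ ((star b * b) Ω) = innerSL ℂ (((‖b Ω‖ : ℂ) ^ 2) • Ω) :=
    φ.isCyclicFamily_gnsRep.ext fun a _ => by
      simp only [innerSL_apply_apply]
      rw [← hinner hb, hφ.inner_eq_of_add φ.gnsRep hsum, inner_smul_left,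
        φ.inner_cyclicVector_gnsRep, map_pow, Complex.conj_ofReal]
  have hΩ : (star b * b) Ω = ((‖b Ω‖ : ℂ) ^ 2) • Ω :=
    ext_inner_right ℂ fun y => DFunLike.congr_fun hfunctional y
  have hstar (a : A) : Commute (star b) (φ.gnsRep a) := by
    simpa only [map_star, star_star] using (hb (star a)).star_star
  refine ⟨(‖b Ω‖ : ℂ) ^ 2, φ.isCyclicFamily_gnsRep.ext fun a _ => ?_⟩
  calc (star b * b) (φ.gnsRep a Ω) = φ.gnsRep a ((star b * b) Ω) :=
        DFunLike.congr_fun ((hstar a).mul_left (hb a)).eq Ω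
    _ = (((‖b Ω‖ : ℂ) ^ 2) • 1 : φ.GNSSpace →L[ℂ] φ.GNSSpace) (φ.gnsRep a Ω) := by
        rw [hΩ, map_smul, smul_apply, one_apply_eq_self]

theorem mem_of_forall_unitary_mem {N : StarSubalgebra ℂ A} [IsClosed (N : Set A)]
    {p : Submodule ℂ A} (h : ∀ u ∈ N, u ∈ unitary A → u ∈ p) {a : A} (ha : a ∈ N) : a ∈ p := by
  have hspan : (⊤ : Submodule ℂ N) ≤ p.comap N.subtype.toAlgHom.toLinearMap := by
    rw [← CStarAlgebra.span_unitary N, Submodule.span_le]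
    exact fun u hu => h u u.2 (Unitary.map_mem N.subtype hu)
  exact hspan (Submodule.mem_top (x := (⟨a, ha⟩ : N)))

theorem mem_centralizer_range_iff {π : A →⋆ₐ[ℂ] (H →L[ℂ] H)} {T : H →L[ℂ] H} :
    T ∈ StarSubalgebra.centralizer ℂ (π.range : Set (H →L[ℂ] H)) ↔ ∀ a, Commute T (π a) := by
  rw [StarSubalgebra.mem_centralizer_iff]
  constructor
  · exact fun h a => ((h _ ⟨a, rfl⟩).1).symm
  · rintro h _ ⟨a, rfl⟩
    have hstar := (h (star a)).symm
    rw [map_star] at hstar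
    exact ⟨(h a).symm, hstar⟩

theorem State.IsPure.isIrreducible_gnsRep {φ : State A} (hφ : φ.IsPure) :
    IsIrreducible φ.gnsRep := by
  let N := StarSubalgebra.centralizer ℂ (φ.gnsRep.range : Set (φ.GNSSpace →L[ℂ] φ.GNSSpace))
  have : IsClosed (N : Set (φ.GNSSpace →L[ℂ] φ.GNSSpace)) := Set.isClosed_centralizer _
  have hN {T} : T ∈ N ↔ ∀ a, Commute T (φ.gnsRep a) := mem_centralizer_range_iff
  have hadd (u) (huN : u ∈ N) (hu : u ∈ unitary (φ.GNSSpace →L[ℂ] φ.GNSSpace)) :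
      ∃ r : ℂ, u + star u = r • 1 := by
    have huu := Unitary.star_mul_self_of_mem hu
    obtain ⟨r, hr⟩ := hφ.star_mul_self_eq_smul
      (hN.mp (N.smul_mem (add_mem (one_mem N) huN) (2⁻¹ : ℂ)))
      (hN.mp (N.smul_mem (sub_mem (one_mem N) huN) (2⁻¹ : ℂ))) (by
        simp [mul_add, add_mul, mul_sub, sub_mul, huu]
        module)
    have h4 : star ((2⁻¹ : ℂ) • (1 + u)) * ((2⁻¹ : ℂ) • (1 + u)) =
        (4⁻¹ : ℂ) • ((2 : ℂ) • 1 + (u + star u)) := by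
      simp [mul_add, add_mul, huu]
      module
    rw [h4, inv_smul_eq_iff₀ four_ne_zero, ← eq_sub_iff_add_eq'] at hr
    exact ⟨4 * r - 2, by rw [hr, sub_smul, mul_smul]⟩
  intro T hT
  have hspan : T ∈ ℂ ∙ (1 : φ.GNSSpace →L[ℂ] φ.GNSSpace) := by
    refine mem_of_forall_unitary_mem (fun u huN hu => ?_) (hN.mpr hT)
    obtain ⟨r, hr⟩ := hadd u huN hu
    obtain ⟨s, hs⟩ := hadd (Complex.I • u) (N.smul_mem huN _)
      (Unitary.smul_mem_of_mem (by simp [Unitary.mem_iff]) hu)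
    rw [star_smul, Complex.star_def, Complex.conj_I] at hs
    refine Submodule.mem_span_singleton.mpr ⟨2⁻¹ * (r - Complex.I * s), ?_⟩
    calc (2⁻¹ * (r - Complex.I * s)) • (1 : φ.GNSSpace →L[ℂ] φ.GNSSpace)
        = (2⁻¹ : ℂ) • (r • 1 - Complex.I • s • 1) := by module
      _ = u := by
        rw [← hr, ← hs, smul_add, smul_smul, smul_smul, mul_neg, Complex.I_mul_I]
        module
  obtain ⟨c, rfl⟩ := Submodule.mem_span_singleton.mp hspan
  exact ⟨c, rfl⟩

end GNS

section MinimalProjections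

variable {H K : Type*} [NormedAddCommGroup H] [InnerProductSpace ℂ H] [CompleteSpace H]
  [NormedAddCommGroup K] [InnerProductSpace ℂ K] [CompleteSpace K]

/-- The operators `ρ r` generate the von Neumann algebra `M`, expressed through its commutant. The
commutant is that of the family alone, so this notion is meant for families closed under
adjoints. -/
def Generates {R : Type*} (ρ : R → K →L[ℂ] K) (M : VonNeumannAlgebra K) : Prop :=
  ∀ c, c ∈ M.commutant ↔ ∀ r, Commute c (ρ r)

/-- A nonzero projection `e ∈ M` with `e M e = ℂ e`. -/
structure IsMinimalProjection (M : VonNeumannAlgebra K) (e : K →L[ℂ] K) : Prop where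
  isStarProjection : IsStarProjection e
  mem : e ∈ M
  ne_zero : e ≠ 0
  exists_smul : ∀ y ∈ M, ∃ c : ℂ, e * y * e = c • e

theorem mem_iff_forall_commute {M : VonNeumannAlgebra K} {y : K →L[ℂ] K} :
    y ∈ M ↔ ∀ c ∈ M.commutant, Commute c y := by
  rw [← M.commutant_commutant, VonNeumannAlgebra.mem_commutant_iff, M.commutant_commutant]
  rfl

theorem generates_bicommutant {A : Type*} [CStarAlgebra A] (ρ : A →⋆ₐ[ℂ] (K →L[ℂ] K)) :
    Generates ρ (bicommutant ρ.range) := by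
  intro c
  let S : Set (K →L[ℂ] K) := ρ.range
  have hbicommutant : (bicommutant ρ.range : Set (K →L[ℂ] K)) =
      Set.centralizer (Set.centralizer (S ∪ star S)) :=
    StarSubalgebra.coe_centralizer_centralizer ℂ S
  rw [← mem_centralizer_range_iff, ← SetLike.mem_coe, VonNeumannAlgebra.coe_commutant,
    hbicommutant, Set.centralizer_centralizer_centralizer, ← StarSubalgebra.coe_centralizer ℂ,
    SetLike.mem_coe]

variable {L R : Type*} [Monoid L] [StarMul L] [Monoid R] [StarMul R]
  {π : L × R →⋆* (H →L[ℂ] H)} {ρ : R →⋆* (K →L[ℂ] K)} {M : VonNeumannAlgebra K} {J : K →ₗᵢ[ℂ] H}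

theorem Generates.mem (hM : Generates ρ M) (r : R) : ρ r ∈ M :=
  mem_iff_forall_commute.mpr fun c hc => (hM c).mp hc r

theorem Generates.exists_inner_eq (hM : Generates ρ M) (hJ : ∀ r k, J (ρ r k) = π (1, r) (J k))
    (l : L) : ∃ c ∈ M.commutant, ∀ r k k',
      inner ℂ (J k) (π (l, r) (J k')) = inner ℂ k (c (ρ r k')) := by
  let c := J.toContinuousLinearMap.adjoint ∘L π (l, 1) ∘L J.toContinuousLinearMap
  have hc (k k' : K) : inner ℂ k (c k') = inner ℂ (J k) (π (l, 1) (J k')) :=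
    J.toContinuousLinearMap.adjoint_inner_right k (π (l, 1) (J k'))
  have hsplit (r : R) : π (l, r) = π (l, 1) * π (1, r) := by
    rw [← map_mul, Prod.mk_mul_mk, one_mul, mul_one]
  have hcomm (r : R) : π (l, 1) * π (1, r) = π (1, r) * π (l, 1) := by
    rw [← hsplit, ← map_mul, Prod.mk_mul_mk, one_mul, mul_one]
  have hstar (r : R) : star (π (1, r)) = π (1, star r) := by
    rw [← map_star, Prod.star_def, star_one]
  refine ⟨c, (hM c).mpr fun r => ?_, fun r k k' => by rw [hc, hJ, hsplit, mul_apply_eq_comp]⟩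
  refine ContinuousLinearMap.ext fun k' => ext_inner_left ℂ fun k => ?_
  calc inner ℂ k (c (ρ r k')) = inner ℂ (J k) ((π (l, 1) * π (1, r)) (J k')) := by
        rw [hc, hJ, mul_apply_eq_comp]
    _ = inner ℂ (J (ρ (star r) k)) (π (l, 1) (J k')) := by
        rw [hcomm, mul_apply_eq_comp, ← ContinuousLinearMap.adjoint_inner_left,
          ← ContinuousLinearMap.star_eq_adjoint, hstar, hJ]
    _ = inner ℂ k (ρ r (c k')) := by
        rw [← hc, map_star, ContinuousLinearMap.star_eq_adjoint,
          ContinuousLinearMap.adjoint_inner_left]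

theorem inner_apply_apply (S T : K →L[ℂ] K) (k k' : K) :
    inner ℂ (S k) (T k') = inner ℂ k ((star S * T) k') :=
  (ContinuousLinearMap.adjoint_inner_right S k (T k')).symm

theorem star_mul_mul_mul_eq {A : Type*} [Monoid A] [StarMul A] {e u c y : A}
    (he : IsStarProjection e) (hu : star u * u = 1) (hue : Commute u e) (hce : Commute c e)
    (hcu : Commute c (star u)) (huy : Commute (e * u * e) (e * y * e)) :
    star (u * e) * (c * y * (u * e)) = star e * (c * y * e) := by
  have hee := he.isIdempotentElem.eq
  have heue : e * u * e = u * e := by rw [← hue.eq, mul_assoc, hee]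
  have hue' : star (u * e) = star u * e := by
    rw [hue.eq, star_mul, he.isSelfAdjoint.star_eq]
  calc star (u * e) * (c * y * (u * e)) = star u * (e * c) * y * (e * u * e) := by
        rw [hue', heue]
        simp only [mul_assoc]
    _ = star u * c * (e * y * e) * (e * u * e) := by
        rw [← hce.eq]
        simp only [mul_assoc, ← mul_assoc e e, hee]
    _ = c * (star u * u) * (e * (e * y * e)) := by
        rw [mul_assoc, ← huy.eq, heue, ← hcu.eq]
        simp only [mul_assoc]
    _ = star e * (c * y * e) := by
        rw [hu, mul_one, he.isSelfAdjoint.star_eq, ← mul_assoc e, ← mul_assoc e, hee, mul_assoc e,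
          ← mul_assoc c, hce.eq]
        simp only [mul_assoc]

/-- As `e M e` is commutative, `e k ↦ u e k` preserves the matrix coefficients of `π`, hence extends
to an operator commuting with `π`, which is a scalar. -/
theorem mul_eq_smul_of_mem_unitary (hπ : IsIrreducible π) (hM : Generates ρ M)
    (hJ : ∀ r k, J (ρ r k) = π (1, r) (J k)) {e : K →L[ℂ] K} (he : IsStarProjection e)
    (heM : e ∈ M) (he0 : e ≠ 0) (hcomm : ∀ x ∈ M, ∀ y ∈ M, Commute (e * x * e) (e * y * e))
    {u : K →L[ℂ] K} (hu : u ∈ unitary (K →L[ℂ] K)) (huM : u ∈ M) (hue : Commute u e) :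
    ∃ c : ℂ, u * e = c • e := by
  obtain ⟨k, hk⟩ : ∃ k, e k ≠ 0 := by
    by_contra! h
    exact he0 (ContinuousLinearMap.ext h)
  have hcyclic : IsCyclicFamily π fun k => J (e k) :=
    hπ.isCyclicFamily (i := k) ((map_ne_zero_iff J J.injective).mpr hk)
  obtain ⟨V, hVe, hV⟩ := hcyclic.exists_linearIsometry (π₂ := π) (w := fun k => J ((u * e) k))
    fun ⟨l, r⟩ k k' => by
      obtain ⟨c, hc, hinner⟩ := hM.exists_inner_eq hJ l
      rw [hinner, hinner]
      exact (inner_apply_apply ..).trans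
        ((congrArg (inner ℂ k <| · k')
          (star_mul_mul_mul_eq he hu.1 hue (mem_iff_forall_commute.mp heM c hc)
            (mem_iff_forall_commute.mp (star_mem huM) c hc) (hcomm u huM _ (hM.mem r)))).trans
          (inner_apply_apply ..).symm)
  obtain ⟨z, hz⟩ := hπ V.toContinuousLinearMap fun g => ContinuousLinearMap.ext (hV g)
  refine ⟨z, ContinuousLinearMap.ext fun k => J.injective ?_⟩
  rw [← hVe]
  simpa using DFunLike.congr_fun hz (J (e k))

theorem isMinimalProjection_of_commute (hπ : IsIrreducible π) (hM : Generates ρ M)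
    (hJ : ∀ r k, J (ρ r k) = π (1, r) (J k)) {e : K →L[ℂ] K} (he : IsStarProjection e)
    (heM : e ∈ M) (he0 : e ≠ 0) (hcomm : ∀ x ∈ M, ∀ y ∈ M, Commute (e * x * e) (e * y * e)) :
    IsMinimalProjection M e := by
  refine ⟨he, heM, he0, fun y hy => ?_⟩
  have hee := he.isIdempotentElem.eq
  let N := M.toStarSubalgebra ⊓ StarSubalgebra.centralizer ℂ {e}
  have : IsClosed (N : Set (K →L[ℂ] K)) := by
    refine IsClosed.inter ?_ (Set.isClosed_centralizer _)
    rw [VonNeumannAlgebra.coe_toStarSubalgebra, ← M.centralizer_centralizer]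
    exact Set.isClosed_centralizer _
  have hyN : e * y * e ∈ N := by
    refine ⟨mul_mem (mul_mem heM hy) heM, (StarSubalgebra.mem_centralizer_iff ℂ).mpr ?_⟩
    intro g hg
    rw [Set.mem_singleton_iff.mp hg, he.isSelfAdjoint.star_eq, mul_assoc _ e e, hee, ← mul_assoc,
      ← mul_assoc, hee]
    exact ⟨rfl, rfl⟩
  have hspan : e * y * e ∈ (ℂ ∙ e).comap (LinearMap.mulRight ℂ e) := by
    refine mem_of_forall_unitary_mem (fun u huN hu => ?_) hyN
    obtain ⟨c, hc⟩ := mul_eq_smul_of_mem_unitary hπ hM hJ he heM he0 hcomm hu huN.1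
      ((StarSubalgebra.mem_centralizer_iff ℂ).mp huN.2 e rfl).1.symm
    exact Submodule.mem_span_singleton.mpr ⟨c, hc.symm⟩
  obtain ⟨c, hc⟩ := Submodule.mem_span_singleton.mp hspan
  exact ⟨c, by rw [hc, LinearMap.mulRight_apply, mul_assoc _ e e, hee]⟩

theorem IsTypeI.exists_isMinimalProjection [Nontrivial K] (htype : IsTypeI M)
    (hπ : IsIrreducible π) (hM : Generates ρ M) (hJ : ∀ r k, J (ρ r k) = π (1, r) (J k)) :
    ∃ e, IsMinimalProjection M e := by
  obtain ⟨e, he, heM, he0, -, hcomm⟩ := htype 1 (.one _) (one_mem _) (one_mem _) one_ne_zero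
  exact ⟨e, isMinimalProjection_of_commute hπ hM hJ he heM he0 hcomm⟩

theorem Generates.conj_mem (hM : Generates ρ M) {σ : R → R} {W : K →L[ℂ] K}
    (hW : Implements ρ σ W) {y : K →L[ℂ] K} (hy : y ∈ M) : W * y * star W ∈ M := by
  refine mem_iff_forall_commute.mpr fun c hc => ?_
  have hc' : star W * c * W ∈ M.commutant := (hM _).mpr fun r =>
    calc star W * c * W * ρ r = star W * (c * ρ (σ r)) * W := by
          rw [mul_assoc, hW.mul_apply, mul_assoc (star W), mul_assoc (star W), mul_assoc c]
      _ = star W * ρ (σ r) * c * W := by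
          rw [((hM c).mp hc (σ r)).eq, ← mul_assoc (star W)]
      _ = ρ r * (star W * c * W) := by
          rw [hW.star_mul_apply, mul_assoc, mul_assoc, mul_assoc]
  have hWW := Unitary.mul_star_self_of_mem hW.mem_unitary
  calc c * (W * y * star W) = W * (star W * c * W * y) * star W := by
        simp only [← mul_assoc, hWW, one_mul]
    _ = W * (y * (star W * c * W)) * star W := by
        rw [(mem_iff_forall_commute.mp hy _ hc').eq]
    _ = W * y * star W * c := by
        simp only [mul_assoc, hWW, mul_one]

theorem inner_apply_eq_mul_of_compression_eq {e y c : K →L[ℂ] K} (he : IsStarProjection e)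
    (hce : Commute c e) {ν : ℂ} (hν : e * y * e = ν • e) {ξ : K} (heξ : e ξ = ξ) :
    inner ℂ ξ (c (y ξ)) = ν * inner ℂ ξ (c ξ) :=
  calc inner ℂ ξ (c (y ξ)) = inner ℂ (e ξ) ((c * y * e) ξ) := by
        simp only [mul_apply_eq_comp, heξ]
    _ = inner ℂ ξ ((c * (e * y * e)) ξ) := by
        rw [inner_apply_apply, he.isSelfAdjoint.star_eq, ← mul_assoc, ← mul_assoc, ← hce.eq]
        simp only [mul_assoc]
    _ = ν * inner ℂ ξ (c ξ) := by
        rw [hν, mul_smul_comm, smul_apply, inner_smul_right, mul_apply_eq_comp, heξ]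

theorem isStarProjection_conj {A : Type*} [Monoid A] [StarMul A] {e w : A}
    (he : IsStarProjection e) (hw : star w * w = 1) : IsStarProjection (w * e * star w) where
  isIdempotentElem := by
    rw [IsIdempotentElem]
    simp only [mul_assoc, ← mul_assoc (star w) w, hw, one_mul, ← mul_assoc e e,
      he.isIdempotentElem.eq]
  isSelfAdjoint := he.isSelfAdjoint.conjugate w

theorem IsMinimalProjection.inner_conj_apply {e : K →L[ℂ] K} (he : IsMinimalProjection M e)
    (hM : Generates ρ M) {σ : R → R} {W : K →L[ℂ] K} (hW : Implements ρ σ W) {ξ : K}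
    (hξ : ‖ξ‖ = 1) (heξ : e ξ = ξ) {f : K →L[ℂ] K} (hf : f = W * e * star W)
    {c : K →L[ℂ] K} (hc : c ∈ M.commutant) (r : R) :
    inner ℂ (f ξ) (c (ρ (σ r) (f ξ))) = (‖f ξ‖ : ℂ) ^ 2 * inner ℂ ξ (c (ρ r ξ)) := by
  have hWW := Unitary.star_mul_self_of_mem hW.mem_unitary
  have hfM : f ∈ M := hf ▸ hM.conj_mem hW he.mem
  have hcf : Commute c f := mem_iff_forall_commute.mp hfM c hc
  have hce : Commute c e := mem_iff_forall_commute.mp he.mem c hc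
  obtain ⟨μ, hμ⟩ := he.exists_smul _ (hM.mem r)
  obtain ⟨ν, hν⟩ := he.exists_smul f hfM
  have hfproj : IsStarProjection f := hf ▸ isStarProjection_conj he.isStarProjection hWW
  have hfρf : f * ρ (σ r) * f = μ • f := by
    rw [hf, ← smul_mul_assoc, ← mul_smul_comm, ← hμ]
    simp only [mul_assoc, hW.star_mul_apply, ← mul_assoc (star W) W, hWW, one_mul]
  have hnorm : (‖f ξ‖ : ℂ) ^ 2 = ν := by
    calc (‖f ξ‖ : ℂ) ^ 2 = inner ℂ (f ξ) (f ξ) :=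
        (inner_self_eq_norm_sq_to_K (𝕜 := ℂ) (f ξ)).symm
      _ = inner ℂ ξ (f ξ) := by
        rw [inner_apply_apply, hfproj.isSelfAdjoint.star_eq, hfproj.isIdempotentElem.eq]
      _ = ν * inner ℂ ξ ξ :=
        inner_apply_eq_mul_of_compression_eq he.isStarProjection (.one_left e) hν heξ
      _ = ν := by simp [inner_self_eq_norm_sq_to_K, hξ]
  calc inner ℂ (f ξ) (c (ρ (σ r) (f ξ))) = inner ℂ ξ ((c * (f * ρ (σ r) * f)) ξ) := by
        refine (inner_apply_apply f (c * ρ (σ r) * f) ξ ξ).trans ?_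
        simp only [hfproj.isSelfAdjoint.star_eq, ← mul_assoc, hcf.eq]
    _ = μ * (ν * inner ℂ ξ (c ξ)) := by
        rw [hfρf, mul_smul_comm, smul_apply, inner_smul_right, mul_apply_eq_comp,
          inner_apply_eq_mul_of_compression_eq he.isStarProjection hce hν heξ]
    _ = (‖f ξ‖ : ℂ) ^ 2 * inner ℂ ξ (c (ρ r ξ)) := by
        rw [inner_apply_eq_mul_of_compression_eq he.isStarProjection hce hμ heξ, hnorm]
        ring

theorem IsMinimalProjection.exists_implements {e : K →L[ℂ] K} (he : IsMinimalProjection M e)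
    (hπ : IsIrreducible π) (hM : Generates ρ M) (hJ : ∀ r k, J (ρ r k) = π (1, r) (J k))
    {σ : R →⋆* R} (hσ : Function.Surjective σ) {W : K →L[ℂ] K} (hW : Implements ρ σ W) {ξ : K}
    (hξ : ‖ξ‖ = 1) (heξ : e ξ = ξ) {f : K →L[ℂ] K} (hf : f = W * e * star W) (hfξ : f ξ ≠ 0) :
    ∃ U, Implements π (Prod.map id σ) U ∧ U (J ξ) = (‖f ξ‖⁻¹ : ℂ) • J (f ξ) := by
  let τ : L × R →⋆* L × R :=
    { (MonoidHom.id L).prodMap σ.toMonoidHom with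
      map_star' := fun p => Prod.ext rfl (map_star σ p.2) }
  have hξ0 : ξ ≠ 0 := norm_ne_zero_iff.mp (hξ ▸ one_ne_zero)
  have hnorm : (‖f ξ‖ : ℂ) ≠ 0 := by simpa using hfξ
  have hv : IsCyclicFamily π fun _ : Unit => J ξ :=
    hπ.isCyclicFamily (i := ()) ((map_ne_zero_iff J J.injective).mpr hξ0)
  have hw : IsCyclicFamily π fun _ : Unit => (‖f ξ‖⁻¹ : ℂ) • J (f ξ) :=
    hπ.isCyclicFamily (i := ())
      (smul_ne_zero (inv_ne_zero hnorm) ((map_ne_zero_iff J J.injective).mpr hfξ))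
  obtain ⟨U, hU, hUξ⟩ := IsCyclicFamily.exists_implements (σ := τ) hv
    (hw.comp_surjective (Function.surjective_id.prodMap hσ)) fun ⟨l, r⟩ _ _ => by
      obtain ⟨c, hc, hinner⟩ := hM.exists_inner_eq hJ l
      change inner ℂ _ (π (l, σ r) _) = _
      rw [map_smul, inner_smul_left, inner_smul_right, hinner, hinner,
        he.inner_conj_apply hM hW hξ heξ hf hc, map_inv₀, Complex.conj_ofReal]
      field_simp
  exact ⟨U, hU, hUξ ()⟩

theorem tendsto_unitary_apply {α : Type*} {l : Filter α} {W : α → K →L[ℂ] K} {x : α → K} {y : K}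
    (hW : ∀ a, W a ∈ unitary (K →L[ℂ] K)) (hWy : Tendsto (W · y) l (𝓝 y))
    (hx : Tendsto x l (𝓝 y)) : Tendsto (fun a => W a (x a)) l (𝓝 y) := by
  rw [tendsto_iff_norm_sub_tendsto_zero] at *
  refine squeeze_zero (fun _ => norm_nonneg _) (fun a => ?_) (by simpa using hx.add hWy)
  calc ‖W a (x a) - y‖ ≤ ‖W a (x a) - W a y‖ + ‖W a y - y‖ := norm_sub_le_norm_sub_add_norm_sub ..
    _ = ‖x a - y‖ + ‖W a y - y‖ := by
        rw [← map_sub, Unitary.norm_map (⟨W a, hW a⟩ : unitary (K →L[ℂ] K))]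

theorem tendsto_star_unitary_apply {α : Type*} {l : Filter α} {W : α → K →L[ℂ] K} {y : K}
    (hW : ∀ a, W a ∈ unitary (K →L[ℂ] K)) (hWy : Tendsto (W · y) l (𝓝 y)) :
    Tendsto (fun a => star (W a) y) l (𝓝 y) := by
  rw [tendsto_iff_norm_sub_tendsto_zero] at *
  refine hWy.congr fun a => ?_
  have hWW : star (W a) (W a y) = y := DFunLike.congr_fun (Unitary.star_mul_self_of_mem (hW a)) y
  rw [norm_sub_rev, ← Unitary.norm_map (⟨_, Unitary.star_mem (hW a)⟩ : unitary (K →L[ℂ] K))]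
  simp [hWW]

theorem tendsto_conj_unitary_apply {α : Type*} {l : Filter α} {W : α → K →L[ℂ] K} {e : K →L[ℂ] K}
    {y : K} (hW : ∀ a, W a ∈ unitary (K →L[ℂ] K)) (hWy : Tendsto (W · y) l (𝓝 y)) (hey : e y = y) :
    Tendsto (fun a => (W a * e * star (W a)) y) l (𝓝 y) := by
  have hlim : Tendsto (fun a => e (star (W a) y)) l (𝓝 (e y)) :=
    (e.continuous.tendsto y).comp (tendsto_star_unitary_apply hW hWy)
  rw [hey] at hlim
  exact (tendsto_unitary_apply hW hWy hlim :)

theorem IsMinimalProjection.exists_norm_eq_one {e : K →L[ℂ] K} (he : IsMinimalProjection M e) :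
    ∃ ξ, ‖ξ‖ = 1 ∧ e ξ = ξ := by
  obtain ⟨k, hk⟩ : ∃ k, e k ≠ 0 := by
    by_contra! h
    exact he.ne_zero (ContinuousLinearMap.ext h)
  refine ⟨(‖e k‖⁻¹ : ℂ) • e k, by simp [norm_smul, hk], ?_⟩
  rw [map_smul, ← mul_apply_eq_comp, he.isStarProjection.isIdempotentElem.eq]

theorem IsMinimalProjection.exists_implements_tendsto {e : K →L[ℂ] K}
    (he : IsMinimalProjection M e) (hπ : IsIrreducible π) (hM : Generates ρ M)
    (hJ : ∀ r k, J (ρ r k) = π (1, r) (J k)) {α : Type*} {l : Filter α} {σ : α → R →⋆* R}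
    (hσ : ∀ a, Function.Surjective (σ a))
    (hσπ : ∀ p, Tendsto (fun a => π (Prod.map id (σ a) p)) l (𝓝 (π p))) {W : α → K →L[ℂ] K}
    (hW : ∀ a, Implements ρ (σ a) (W a)) (hW1 : ∀ k, Tendsto (W · k) l (𝓝 k)) :
    ∃ U : α → H →L[ℂ] H, (∀ᶠ a in l, Implements π (Prod.map id (σ a)) (U a)) ∧
      ∀ x, Tendsto (U · x) l (𝓝 x) := by
  obtain ⟨ξ, hξ, heξ⟩ := he.exists_norm_eq_one
  let f (a : α) : K →L[ℂ] K := W a * e * star (W a)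
  have hfξ : Tendsto (f · ξ) l (𝓝 ξ) :=
    tendsto_conj_unitary_apply (fun a => (hW a).mem_unitary) (hW1 ξ) heξ
  have hξ0 : ξ ≠ 0 := norm_ne_zero_iff.mp (hξ ▸ one_ne_zero)
  have hchoice (a : α) : ∃ U ∈ unitary (H →L[ℂ] H), f a ξ ≠ 0 →
      Implements π (Prod.map id (σ a)) U ∧ U (J ξ) = (‖f a ξ‖⁻¹ : ℂ) • J (f a ξ) := by
    by_cases hfa : f a ξ = 0
    · exact ⟨1, one_mem _, fun h => (h hfa).elim⟩
    · obtain ⟨U, hU, hUξ⟩ := he.exists_implements hπ hM hJ (hσ a) (hW a) hξ heξ rfl hfa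
      exact ⟨U, hU.mem_unitary, fun _ => ⟨hU, hUξ⟩⟩
  choose U hUmem hU using hchoice
  have hne : ∀ᶠ a in l, f a ξ ≠ 0 := hfξ.eventually_ne hξ0
  have hUσ : ∀ᶠ a in l, Implements π (Prod.map id (σ a)) (U a) := hne.mono fun a h => (hU a h).1
  have hcyclic : IsCyclicFamily π fun _ : Unit => J ξ :=
    hπ.isCyclicFamily (i := ()) ((map_ne_zero_iff J J.injective).mpr hξ0)
  refine ⟨U, hUσ, hcyclic.tendsto_of_implements hUmem hUσ hσπ fun _ => ?_⟩
  have hlim : Tendsto (fun a => (‖f a ξ‖⁻¹ : ℂ) • J (f a ξ)) l (𝓝 ((‖ξ‖⁻¹ : ℂ) • J ξ)) := by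
    have hnorm : Tendsto (fun a => (‖f a ξ‖ : ℂ)) l (𝓝 ‖ξ‖) :=
      (Complex.continuous_ofReal.comp continuous_norm).tendsto ξ |>.comp hfξ
    exact (hnorm.inv₀ (by simpa using hξ0)).smul ((J.continuous.tendsto ξ).comp hfξ)
  simp only [hξ, Complex.ofReal_one, inv_one, one_smul] at hlim
  exact hlim.congr' (hne.mono fun a h => ((hU a h).2).symm)

end MinimalProjections

section LocalAlgebras

theorem site_mem_localAlgebra {Λ : Set ℤ} {j : ℤ} (hj : j ∈ Λ) (Q : Matrix (Fin 2) (Fin 2) ℂ) :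
    site j Q ∈ localAlgebra Λ :=
  StarSubalgebra.le_topologicalClosure _ (StarAlgebra.subset_adjoin ℂ _ ⟨j, hj, Q, rfl⟩)

/-- A one-site observable as an element of the algebra of the observables localized in `Λ`. -/
noncomputable def localSite {Λ : Set ℤ} {j : ℤ} (hj : j ∈ Λ) (Q : Matrix (Fin 2) (Fin 2) ℂ) :
    localAlgebra Λ :=
  ⟨site j Q, site_mem_localAlgebra hj Q⟩

theorem localAlgebra_le {Λ : Set ℤ} {B : StarSubalgebra ℂ quasiLocal}
    (hB : IsClosed (B : Set quasiLocal)) (h : ∀ j ∈ Λ, ∀ Q, site j Q ∈ B) :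
    localAlgebra Λ ≤ B := by
  refine StarSubalgebra.topologicalClosure_minimal (StarAlgebra.adjoin_le ?_) hB
  rintro _ ⟨j, hj, Q, rfl⟩
  exact h j hj Q

theorem eq_top_of_site_mem {B : StarSubalgebra ℂ quasiLocal}
    (hB : IsClosed (B : Set quasiLocal)) (h : ∀ j Q, site j Q ∈ B) : B = ⊤ := by
  have hclosed : IsClosed (B.map quasiLocal.subtype : Set (Space →L[ℂ] Space)) :=
    isClosed_quasiLocal.isClosedEmbedding_subtypeVal.isClosedMap _ hB
  have hle : quasiLocal ≤ B.map quasiLocal.subtype := by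
    refine StarSubalgebra.topologicalClosure_minimal (StarAlgebra.adjoin_le ?_) hclosed
    rintro _ ⟨j, Q, rfl⟩
    exact ⟨site j Q, h j Q, rfl⟩
  refine eq_top_iff.mpr fun a _ => ?_
  obtain ⟨b, hb, hab⟩ := hle a.2
  rwa [← Subtype.ext (a1 := b) (a2 := a) hab]

theorem localAlgebra_univ : localAlgebra Set.univ = ⊤ :=
  eq_top_of_site_mem (isClosed_localAlgebra _) fun _ Q => site_mem_localAlgebra (Set.mem_univ _) Q

theorem commute_of_commute_site {B : Type*} [CStarAlgebra B] {Λ : Set ℤ} (π : quasiLocal →⋆ₐ[ℂ] B)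
    {S : B} (h : ∀ j ∈ Λ, ∀ Q, Commute S (π (site j Q))) {a : quasiLocal}
    (ha : a ∈ localAlgebra Λ) : Commute S (π a) := by
  have hle : localAlgebra Λ ≤ (StarSubalgebra.centralizer ℂ {S}).comap π := by
    refine localAlgebra_le ((Set.isClosed_centralizer _).preimage (map_continuous π))
      fun j hj Q => (StarSubalgebra.mem_centralizer_iff ℂ).mpr ?_
    rintro _ rfl
    have hstar := (h j hj (star Q)).star_star
    rw [map_star, map_star, star_star] at hstar
    exact ⟨h j hj Q, hstar⟩
  exact ((StarSubalgebra.mem_centralizer_iff ℂ).mp (hle ha) S rfl).1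

theorem site_commute {j k : ℤ} (h : j ≠ k) (Q R : Matrix (Fin 2) (Fin 2) ℂ) :
    Commute (site j Q) (site k R) :=
  Subtype.ext (siteOp_commute h Q R).eq

theorem commute_of_mem_localAlgebra {Λ Λ' : Set ℤ} (h : Disjoint Λ Λ') {a b : quasiLocal}
    (ha : a ∈ localAlgebra Λ) (hb : b ∈ localAlgebra Λ') : Commute a b :=
  commute_of_commute_site (.id ℂ quasiLocal) (fun _ hk R => .symm <|
    commute_of_commute_site (.id ℂ quasiLocal)
      (fun _ hj Q => site_commute (h.ne_of_mem hj hk).symm R Q) ha) hb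

theorem starAlgHom_ext_site {B : Type*} [CStarAlgebra B] {f g : quasiLocal →⋆ₐ[ℂ] B}
    (h : ∀ j Q, f (site j Q) = g (site j Q)) : f = g := by
  have htop : StarAlgHom.equalizer f g = ⊤ :=
    eq_top_of_site_mem (isClosed_eq (map_continuous f) (map_continuous g)) h
  ext a
  exact htop.ge (StarSubalgebra.mem_top (x := a))

theorem continuous_site (j : ℤ) : Continuous (site j) :=
  LinearMap.continuous_of_finiteDimensional (site j).toAlgHom.toLinearMap

end LocalAlgebras

section Gauge

theorem rotZ_mul (θ θ' : ℝ) : rotZ θ * rotZ θ' = rotZ (θ + θ') := by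
  rw [rotZ, rotZ, rotZ, Matrix.diagonal_mul_diagonal]
  congr 1
  ext i
  fin_cases i <;> simp [← Complex.exp_add] <;> ring_nf

theorem rotZ_zero : rotZ 0 = 1 := by
  rw [rotZ, ← Matrix.diagonal_one]
  congr 1
  ext i
  fin_cases i <;> simp

theorem continuous_rotZ : Continuous rotZ := by
  refine Continuous.matrix_diagonal (continuous_pi (Fin.forall_fin_two.mpr ⟨?_, ?_⟩))
  · simp only [Matrix.cons_val_zero]
    fun_prop
  · simp only [Matrix.cons_val_one, Matrix.cons_val_fin_one]
    fun_prop

theorem gauge_neg_gauge (θ : ℝ) (a : quasiLocal) : gauge (-θ) (gauge θ a) = a := by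
  have hcomp : ((gauge (-θ)).toStarAlgHom.comp (gauge θ).toStarAlgHom :
      quasiLocal →⋆ₐ[ℂ] quasiLocal) = .id ℂ quasiLocal := starAlgHom_ext_site fun j Q => by
    change gauge (-θ) (gauge θ (site j Q)) = site j Q
    rw [gauge_site, gauge_site, neg_neg, mul_assoc, mul_assoc, rotZ_mul, neg_add_cancel,
      rotZ_zero, mul_one, ← mul_assoc, rotZ_mul, neg_add_cancel, rotZ_zero, one_mul]
  exact DFunLike.congr_fun hcomp a

theorem gauge_mem {Λ : Set ℤ} (θ : ℝ) {a : quasiLocal} (ha : a ∈ localAlgebra Λ) :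
    gauge θ a ∈ localAlgebra Λ := by
  have hle : localAlgebra Λ ≤ (localAlgebra Λ).comap (gauge θ).toStarAlgHom :=
    localAlgebra_le ((isClosed_localAlgebra Λ).preimage (map_continuous (gauge θ)))
      fun j hj Q => ((gauge_site θ j Q).symm ▸ site_mem_localAlgebra hj _ :
        gauge θ (site j Q) ∈ localAlgebra Λ)
  exact hle ha

theorem tendsto_gauge (a : quasiLocal) : Tendsto (fun θ => gauge θ a) (𝓝 0) (𝓝 a) := by
  let B : StarSubalgebra ℂ quasiLocal :=
    { carrier := {a | Tendsto (fun θ => gauge θ a) (𝓝 0) (𝓝 a)}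
      mul_mem' := fun {a b} ha hb => by simpa using ha.mul hb
      add_mem' := fun {a b} ha hb => by simpa using ha.add hb
      algebraMap_mem' := fun r => by
        have hfix (θ : ℝ) : gauge θ (algebraMap ℂ quasiLocal r) = algebraMap ℂ quasiLocal r :=
          AlgHomClass.commutes (gauge θ) r
        simpa only [Set.mem_ofPred_eq, hfix] using tendsto_const_nhds
      star_mem' := fun {a} ha => by
        simp only [Set.mem_ofPred_eq, map_star] at *
        exact ha.star }
  have hB : IsClosed (B : Set quasiLocal) :=
    isClosed_setOf_tendsto_self (fun θ => LipschitzWith.of_dist_le_mul fun x y => by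
      simpa [dist_eq_norm, ← map_sub] using NonUnitalStarAlgHom.norm_apply_le (gauge θ) (x - y)) _
  have htop : B = ⊤ := eq_top_of_site_mem hB fun j Q => by
    have hcont : Continuous fun θ => site j (rotZ θ * Q * rotZ (-θ)) :=
      (continuous_site j).comp ((continuous_rotZ.mul continuous_const).mul
        (continuous_rotZ.comp continuous_neg))
    change Tendsto (fun θ => gauge θ (site j Q)) (𝓝 0) (𝓝 (site j Q))
    simpa [gauge_site, rotZ_zero] using hcont.tendsto 0
  exact htop.ge (StarSubalgebra.mem_top (x := a))

/-- The gauge action on the observables localized in `Λ`. -/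
noncomputable def localGauge (Λ : Set ℤ) (θ : ℝ) : localAlgebra Λ ≃⋆ₐ[ℂ] localAlgebra Λ :=
  let restrict (θ : ℝ) : localAlgebra Λ →⋆ₐ[ℂ] localAlgebra Λ :=
    ((gauge θ).toStarAlgHom.comp (localAlgebra Λ).subtype).codRestrict _
      fun a => gauge_mem θ a.2
  .ofStarAlgHom (restrict θ) (restrict (-θ))
    (StarAlgHom.ext fun a => Subtype.ext (gauge_neg_gauge θ a))
    (StarAlgHom.ext fun a => Subtype.ext (by
      change gauge θ (gauge (-θ) a) = a
      simpa only [neg_neg] using gauge_neg_gauge (-θ) (a : quasiLocal)))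

theorem localGauge_localSite {Λ : Set ℤ} {j : ℤ} (hj : j ∈ Λ) (θ : ℝ)
    (Q : Matrix (Fin 2) (Fin 2) ℂ) :
    localGauge Λ θ (localSite hj Q) = localSite hj (rotZ θ * Q * rotZ (-θ)) :=
  Subtype.ext (gauge_site θ j Q)

theorem tendsto_localGauge {Λ : Set ℤ} (a : localAlgebra Λ) :
    Tendsto (fun θ => localGauge Λ θ a) (𝓝 0) (𝓝 a) :=
  tendsto_subtype_rng.mpr (tendsto_gauge a)

end Gauge

section HalfRotation

/-- The observables localized in the left half-chain `(-∞, 0]`. -/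
noncomputable abbrev leftAlgebra : StarSubalgebra ℂ quasiLocal := localAlgebra (Set.Iic 0)

theorem commute_left_right (a : leftAlgebra) (b : rightAlgebra) :
    Commute (a : quasiLocal) (b : quasiLocal) :=
  commute_of_mem_localAlgebra ((Set.Iic_disjoint_Ici).mpr (by norm_num)) a.2 b.2

/-- The product of a left and a right half-chain observable; `𝔄` is generated by such products, so
this exhibits a representation of `𝔄` as one of the pair of half-chain algebras. -/
noncomputable def halfChainMul : leftAlgebra × rightAlgebra →⋆* quasiLocal where
  toFun p := p.1 * p.2
  map_one' := mul_one 1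
  map_mul' p q := ((commute_left_right q.1 p.2).mul_mul_mul_comm p.1 q.2)
  map_star' p := by
    rw [star_mul]
    exact commute_left_right (star p.1) (star p.2)

variable {H : Type*} [NormedAddCommGroup H] [InnerProductSpace ℂ H] [CompleteSpace H]
  (π : quasiLocal →⋆ₐ[ℂ] (H →L[ℂ] H))

/-- The operators representing the one-site observables. -/
noncomputable def siteRep (p : ℤ × Matrix (Fin 2) (Fin 2) ℂ) : H →L[ℂ] H :=
  π (site p.1 p.2)

/-- The representation of pairs of half-chain observables, `(a, b) ↦ π (a * b)`. -/
noncomputable def halfChainRep : leftAlgebra × rightAlgebra →⋆* (H →L[ℂ] H) :=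
  (StarMonoidHom.ofClass π).comp halfChainMul

open Classical in
/-- The substitution of one-site observables that rotates the spins at the sites of `Λ` by the
angle `θ`. -/
noncomputable def siteRotation (Λ : Set ℤ) (θ : ℝ) (p : ℤ × Matrix (Fin 2) (Fin 2) ℂ) :
    ℤ × Matrix (Fin 2) (Fin 2) ℂ :=
  (p.1, if p.1 ∈ Λ then rotZ θ * p.2 * rotZ (-θ) else p.2)

variable {π}

theorem isIrreducible_siteRep (hπ : IsIrreducible π) : IsIrreducible (siteRep π) := fun T hT =>
  hπ T fun _ => commute_of_commute_site π (Λ := Set.univ) (fun j _ Q => hT (j, Q))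
    (localAlgebra_univ ▸ StarSubalgebra.mem_top)

theorem halfChainRep_left {j : ℤ} (hj : j ∈ Set.Iic 0) (Q : Matrix (Fin 2) (Fin 2) ℂ) :
    halfChainRep π (localSite hj Q, 1) = siteRep π (j, Q) :=
  congrArg π (mul_one (site j Q))

theorem halfChainRep_right {j : ℤ} (hj : j ∈ Set.Ici 1) (Q : Matrix (Fin 2) (Fin 2) ℂ) :
    halfChainRep π (1, localSite hj Q) = siteRep π (j, Q) :=
  congrArg π (one_mul (site j Q))

theorem mem_Iic_or_mem_Ici (j : ℤ) : j ∈ Set.Iic 0 ∨ j ∈ Set.Ici 1 := by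
  simp only [Set.mem_Iic, Set.mem_Ici]
  lia

theorem isIrreducible_halfChainRep (hπ : IsIrreducible π) : IsIrreducible (halfChainRep π) :=
  fun T hT => isIrreducible_siteRep hπ T fun ⟨j, Q⟩ => by
    rcases mem_Iic_or_mem_Ici j with hj | hj
    · exact halfChainRep_left (π := π) hj Q ▸ hT _
    · exact halfChainRep_right (π := π) hj Q ▸ hT _

theorem implements_siteRotation {θ : ℝ} {U : H →L[ℂ] H}
    (hU : Implements (halfChainRep π) (Prod.map id (localGauge (Set.Ici 1) θ)) U) :
    Implements (siteRep π) (siteRotation (Set.Ici 1) θ) U := by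
  refine ⟨hU.1, fun ⟨j, Q⟩ => ?_⟩
  rcases mem_Iic_or_mem_Ici j with hj | hj
  · have hfix : localGauge (Set.Ici 1) θ 1 = 1 := map_one (localGauge (Set.Ici 1) θ)
    have hleft := hU.2 (localSite hj Q, 1)
    simp only [Prod.map, id, hfix] at hleft
    rw [halfChainRep_left hj Q] at hleft
    have hj' : j ∉ Set.Ici 1 := not_le.mpr (Int.lt_add_one_iff.mpr (Set.mem_Iic.mp hj))
    simpa only [siteRotation, if_neg hj'] using hleft
  · have hright := hU.2 (1, localSite hj Q)
    simp only [Prod.map, id, localGauge_localSite] at hright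
    rw [halfChainRep_right hj, halfChainRep_right hj] at hright
    simpa only [siteRotation, if_pos hj] using hright

theorem exists_implements_localGauge_tendsto {Λ : Set ℤ} {ψ : State (localAlgebra Λ)}
    (hgauge : ∀ (θ : ℝ) a, ψ (localGauge Λ θ a) = ψ a) :
    ∃ W : ℝ → ψ.GNSSpace →L[ℂ] ψ.GNSSpace,
      (∀ θ, Implements ψ.gnsRep (localGauge Λ θ) (W θ)) ∧
        ∀ k, Tendsto (W · k) (𝓝 0) (𝓝 k) := by
  choose W hW hfix using fun θ => ψ.exists_implements_of_invariant (localGauge Λ θ) (hgauge θ)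
  refine ⟨W, hW, ψ.isCyclicFamily_gnsRep.tendsto_of_implements (fun θ => (hW θ).1)
    (.of_forall hW) (fun a => ?_) fun _ => ?_⟩
  · exact ((map_continuous ψ.gnsRep).tendsto a).comp (tendsto_localGauge a)
  · simpa only [hfix] using tendsto_const_nhds

variable {K : Type*} [NormedAddCommGroup K] [InnerProductSpace ℂ K] [CompleteSpace K]
  {ρ : rightAlgebra →⋆ₐ[ℂ] (K →L[ℂ] K)}

theorem IsIrreducible.exists_implements_siteRotation_tendsto [Nontrivial K] (hπ : IsIrreducible π)
    (htype : IsTypeI (bicommutant ρ.range))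
    (hsub : ∃ J : K →ₗᵢ[ℂ] H, ∀ b k, J (ρ b k) = π b (J k))
    (hgauge : ∃ W : ℝ → K →L[ℂ] K, (∀ θ, Implements ρ (localGauge (Set.Ici 1) θ) (W θ)) ∧
      ∀ k, Tendsto (W · k) (𝓝 0) (𝓝 k)) :
    ∃ U : ℝ → H →L[ℂ] H,
      (∀ᶠ θ in 𝓝 0, Implements (siteRep π) (siteRotation (Set.Ici 1) θ) (U θ)) ∧
        ∀ x, Tendsto (U · x) (𝓝 0) (𝓝 x) := by
  obtain ⟨J, hJ⟩ := hsub
  obtain ⟨W, hW, hW1⟩ := hgauge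
  have hJ' (b : rightAlgebra) (k : K) : J (ρ b k) = halfChainRep π (1, b) (J k) :=
    (hJ b k).trans (congrArg (fun a => π a (J k)) (one_mul (b : quasiLocal)).symm)
  have hirr := isIrreducible_halfChainRep hπ
  have hgen : Generates (StarMonoidHom.ofClass ρ) _ := generates_bicommutant ρ
  obtain ⟨e, he⟩ := htype.exists_isMinimalProjection hirr hgen hJ'
  have hcont (p : leftAlgebra × rightAlgebra) :
      Tendsto (fun θ => halfChainRep π (Prod.map id (localGauge _ θ) p)) (𝓝 0)
        (𝓝 (halfChainRep π p)) :=
    ((map_continuous π).tendsto _).comp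
      ((tendsto_gauge (p.2 : quasiLocal)).const_mul (p.1 : quasiLocal))
  obtain ⟨U, hU, hU1⟩ := he.exists_implements_tendsto hirr hgen hJ'
    (σ := fun θ => .ofClass (localGauge (Set.Ici 1) θ))
    (fun θ => (localGauge _ θ).surjective) hcont hW hW1
  exact ⟨U, hU.mono fun θ => implements_siteRotation, hU1⟩

theorem State.IsPure.exists_implements_siteRotation_tendsto {φ : State quasiLocal}
    (hpure : φ.IsPure) (hgauge : ∀ (θ : ℝ) (a : quasiLocal), φ (gauge θ a) = φ a)
    (htypeI : (φ.restrict rightAlgebra).IsTypeIRep) :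
    ∃ U : ℝ → φ.GNSSpace →L[ℂ] φ.GNSSpace,
      (∀ᶠ θ in 𝓝 0, Implements (siteRep φ.gnsRep) (siteRotation (Set.Ici 1) θ) (U θ)) ∧
        ∀ x, Tendsto (U · x) (𝓝 0) (𝓝 x) :=
  have := (φ.restrict rightAlgebra).nontrivial_gnsSpace
  hpure.isIrreducible_gnsRep.exists_implements_siteRotation_tendsto htypeI
    (φ.exists_linearIsometry_restrict rightAlgebra)
    (exists_implements_localGauge_tendsto (ψ := φ.restrict rightAlgebra) fun θ a => hgauge θ a)

end HalfRotation

section PhaseMatrix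

/-- The diagonal matrix with entries `1` and `z`, which multiplies a down spin by the phase `z`. -/
def phaseMatrix (z : ℂ) : Matrix (Fin 2) (Fin 2) ℂ :=
  Matrix.diagonal ![1, z]

theorem phaseMatrix_eq_single_add (z : ℂ) :
    phaseMatrix z = Matrix.single 0 0 1 + z • Matrix.single 1 1 1 := by
  ext i j
  fin_cases i <;> fin_cases j <;> simp [phaseMatrix]

theorem phaseMatrix_one : phaseMatrix 1 = 1 := by
  ext i j
  fin_cases i <;> fin_cases j <;> simp [phaseMatrix]

theorem phaseMatrix_mul (z w : ℂ) : phaseMatrix z * phaseMatrix w = phaseMatrix (z * w) := by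
  rw [phaseMatrix, phaseMatrix, Matrix.diagonal_mul_diagonal]
  exact congrArg _ (List.ofFn_injective (by simp))

theorem star_phaseMatrix (z : ℂ) : star (phaseMatrix z) = phaseMatrix (star z) := by
  ext i j
  fin_cases i <;> fin_cases j <;> simp [phaseMatrix]

theorem coe_circle_mem_unitary (z : Circle) : (z : ℂ) ∈ unitary ℂ := by
  rw [Unitary.mem_iff_self_mul_star, Complex.star_def, Complex.mul_conj, Circle.normSq_coe,
    Complex.ofReal_one]

theorem site_phaseMatrix_mem_unitary (j : ℤ) (z : Circle) :
    site j (phaseMatrix z) ∈ unitary quasiLocal := by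
  obtain ⟨hz, hz'⟩ := Unitary.mem_iff.mp (coe_circle_mem_unitary z)
  rw [Unitary.mem_iff, ← map_star, ← map_mul, ← map_mul, star_phaseMatrix, phaseMatrix_mul,
    phaseMatrix_mul, hz, hz', phaseMatrix_one, map_one]
  exact ⟨rfl, rfl⟩

theorem phaseMatrix_exp_neg (θ : ℝ) :
    phaseMatrix (Circle.exp (-θ)) = Complex.exp (-(Complex.I * θ / 2)) • rotZ θ := by
  rw [phaseMatrix, rotZ, ← Matrix.diagonal_smul]
  refine congrArg _ (List.ofFn_injective ?_)
  simp only [List.ofFn_succ, List.ofFn_zero, Pi.smul_apply, smul_eq_mul, Circle.coe_exp,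
    Matrix.cons_val_zero, Matrix.cons_val_succ, ← Complex.exp_add]
  rw [neg_add_cancel, Complex.exp_zero]
  push_cast
  ring_nf

theorem phaseMatrix_exp_neg_mul (θ : ℝ) (Q : Matrix (Fin 2) (Fin 2) ℂ) :
    phaseMatrix (Circle.exp (-θ)) * Q =
      rotZ θ * Q * rotZ (-θ) * phaseMatrix (Circle.exp (-θ)) := by
  rw [phaseMatrix_exp_neg, smul_mul_assoc, mul_smul_comm, mul_assoc _ _ (rotZ θ), rotZ_mul,
    neg_add_cancel, rotZ_zero, mul_one]

theorem rotZ_mul_mul_rotZ_neg_of_exp_eq_one {θ : ℝ} (hθ : Circle.exp θ = 1)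
    (Q : Matrix (Fin 2) (Fin 2) ℂ) : rotZ θ * Q * rotZ (-θ) = Q := by
  simpa [Circle.exp_neg, hθ, phaseMatrix_one] using (phaseMatrix_exp_neg_mul θ Q).symm

end PhaseMatrix

section SiteSubstitutions

/-- The substitution of one-site observables that moves the sites by `k`. -/
def siteShift (k : ℤ) (p : ℤ × Matrix (Fin 2) (Fin 2) ℂ) : ℤ × Matrix (Fin 2) (Fin 2) ℂ :=
  (p.1 + k, p.2)

theorem rightInverse_siteShift (k : ℤ) :
    Function.RightInverse (siteShift (-k)) (siteShift k) := fun p =>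
  Prod.ext (neg_add_cancel_right p.1 k) rfl

theorem siteShift_comp_siteRotation_comp_siteShift (k : ℤ) (Λ : Set ℤ) (θ : ℝ) :
    siteShift k ∘ siteRotation Λ θ ∘ siteShift (-k) = siteRotation {j | j + -k ∈ Λ} θ :=
  funext fun p => Prod.ext (neg_add_cancel_right p.1 k) rfl

theorem siteRotation_comp_of_disjoint {Λ Λ' : Set ℤ} (h : Disjoint Λ Λ') (θ : ℝ) :
    siteRotation Λ θ ∘ siteRotation Λ' θ = siteRotation (Λ ∪ Λ') θ := by
  refine funext fun ⟨j, Q⟩ => Prod.ext rfl ?_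
  by_cases hj : j ∈ Λ
  · simp only [siteRotation, Function.comp_apply, hj, h.notMem_of_mem_left hj, Set.mem_union,
      or_false, if_true, if_false]
  · by_cases hj' : j ∈ Λ' <;>
      simp only [siteRotation, Function.comp_apply, hj, hj', Set.mem_union, or_true, or_false,
        if_true, if_false]

theorem siteRotation_comp_siteRotation (Λ : Set ℤ) (θ θ' : ℝ) :
    siteRotation Λ θ ∘ siteRotation Λ θ' = siteRotation Λ (θ + θ') := by
  refine funext fun ⟨j, Q⟩ => Prod.ext rfl ?_
  by_cases hj : j ∈ Λ
  · simp only [siteRotation, Function.comp_apply, hj, if_true]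
    rw [← rotZ_mul, neg_add_rev, ← rotZ_mul]
    simp only [mul_assoc]
  · simp only [siteRotation, Function.comp_apply, hj, if_false]

theorem siteRotation_of_exp_eq_one (Λ : Set ℤ) {θ : ℝ} (hθ : Circle.exp θ = 1) :
    siteRotation Λ θ = id := by
  refine funext fun ⟨j, Q⟩ => Prod.ext rfl ?_
  simp [siteRotation, rotZ_mul_mul_rotZ_neg_of_exp_eq_one hθ]

theorem siteRotation_iterate (Λ : Set ℤ) (θ : ℝ) (n : ℕ) :
    (siteRotation Λ θ)^[n] = siteRotation Λ (n * θ) := by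
  induction n with
  | zero => simp [siteRotation_of_exp_eq_one]
  | succ n ih =>
    rw [Function.iterate_succ, ih, siteRotation_comp_siteRotation, Nat.cast_succ, add_one_mul]

end SiteSubstitutions

section Character

variable {H : Type*} [NormedAddCommGroup H] [InnerProductSpace ℂ H] [CompleteSpace H]
  {π : quasiLocal →⋆ₐ[ℂ] (H →L[ℂ] H)} {T U V : H →L[ℂ] H} {θ θ' : ℝ}

theorem exists_implements_of_eventually {Λ : Set ℤ} {U : ℝ → H →L[ℂ] H}
    (hU : ∀ᶠ θ in 𝓝 0, Implements (siteRep π) (siteRotation Λ θ) (U θ)) (θ : ℝ) :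
    ∃ V, Implements (siteRep π) (siteRotation Λ θ) V := by
  obtain ⟨n, hn, hn0⟩ := (((tendsto_const_div_atTop_nhds_zero_nat θ).eventually hU).and
    (eventually_gt_atTop 0)).exists
  have hpow := hn.pow n
  rw [siteRotation_iterate, mul_div_cancel₀ θ (Nat.cast_ne_zero.mpr hn0.ne')] at hpow
  exact ⟨_, hpow⟩

theorem Implements.siteRep_siteShift (hT : Implements π (translation 1) T) :
    Implements (siteRep π) (siteShift 1) T :=
  ⟨hT.mem_unitary, fun p => by
    rw [siteRep, hT.mul_apply, translation_site, siteRep, siteShift, add_comm]⟩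

theorem implements_siteRotation_singleton (π : quasiLocal →⋆ₐ[ℂ] (H →L[ℂ] H)) (j : ℤ) (θ : ℝ) :
    Implements (siteRep π) (siteRotation {j} θ)
      (π (site j (phaseMatrix (Circle.exp (-θ))))) := by
  refine ⟨Unitary.map_mem π (site_phaseMatrix_mem_unitary j _), fun ⟨k, Q⟩ => ?_⟩
  rcases eq_or_ne k j with rfl | hk
  · simp only [siteRep, siteRotation, Set.mem_singleton_iff, if_true, ← map_mul,
      phaseMatrix_exp_neg_mul]
  · simpa only [siteRep, siteRotation, Set.mem_singleton_iff, if_neg hk] using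
      ((site_commute hk.symm _ Q).map π).eq

/-- The translate by one site of an operator rotating the half-chain `[1, ∞)`, completed by a
rotation of the spin at the site `1`. -/
noncomputable def shiftImplementer (π : quasiLocal →⋆ₐ[ℂ] (H →L[ℂ] H)) (T : H →L[ℂ] H) (θ : ℝ)
    (U : H →L[ℂ] H) : H →L[ℂ] H :=
  π (site 1 (phaseMatrix (Circle.exp (-θ)))) * (T * U * star T)

theorem Implements.conj_siteShift (hT : Implements π (translation 1) T)
    (hU : Implements (siteRep π) (siteRotation (Set.Ici 1) θ) U) :
    Implements (siteRep π) (siteRotation (Set.Ici 2) θ) (T * U * star T) := by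
  have hset : {j : ℤ | j + -1 ∈ Set.Ici (1 : ℤ)} = Set.Ici 2 := by
    ext j
    simp only [Set.mem_ofPred_eq, Set.mem_Ici]
    omega
  have hconj := hT.siteRep_siteShift.mul
    (hU.mul (hT.siteRep_siteShift.inv (rightInverse_siteShift 1)))
  rwa [siteShift_comp_siteRotation_comp_siteShift, hset, ← mul_assoc] at hconj

theorem Implements.shiftImplementer (hT : Implements π (translation 1) T)
    (hU : Implements (siteRep π) (siteRotation (Set.Ici 1) θ) U) :
    Implements (siteRep π) (siteRotation (Set.Ici 1) θ) (shiftImplementer π T θ U) := by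
  have hset : {1} ∪ Set.Ici 2 = Set.Ici (1 : ℤ) := by
    ext j
    simp only [Set.mem_union, Set.mem_singleton_iff, Set.mem_Ici]
    omega
  have hmul := (implements_siteRotation_singleton π 1 θ).mul (hT.conj_siteShift hU)
  rwa [siteRotation_comp_of_disjoint (by simp), hset] at hmul

theorem shiftImplementer_mul (hT : Implements π (translation 1) T)
    (hU : Implements (siteRep π) (siteRotation (Set.Ici 1) θ) U) :
    shiftImplementer π T (θ + θ') (U * V) =
      shiftImplementer π T θ U * shiftImplementer π T θ' V := by
  have hphase : phaseMatrix (Circle.exp (-(θ + θ'))) =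
      phaseMatrix (Circle.exp (-θ)) * phaseMatrix (Circle.exp (-θ')) := by
    rw [phaseMatrix_mul, neg_add, Circle.exp_add, Circle.coe_mul]
  have hcomm : T * U * star T * π (site 1 (phaseMatrix (Circle.exp (-θ')))) =
      π (site 1 (phaseMatrix (Circle.exp (-θ')))) * (T * U * star T) := by
    simpa [siteRep, siteRotation] using
      (hT.conj_siteShift hU).mul_apply (1, phaseMatrix (Circle.exp (-θ')))
  have hconj : T * (U * V) * star T = T * U * star T * (T * V * star T) := by
    rw [mul_assoc (T * U), ← mul_assoc (star T), ← mul_assoc (star T),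
      Unitary.star_mul_self_of_mem hT.mem_unitary, one_mul]
    simp only [mul_assoc]
  rw [shiftImplementer, shiftImplementer, shiftImplementer, hphase, map_mul, map_mul, hconj]
  exact Commute.mul_mul_mul_comm hcomm.symm _ _

theorem shiftImplementer_one (hT : T ∈ unitary (H →L[ℂ] H)) (hθ : Circle.exp θ = 1) :
    shiftImplementer π T θ 1 = 1 := by
  rw [shiftImplementer, Circle.exp_neg, hθ, inv_one, Circle.coe_one, phaseMatrix_one, map_one,
    map_one, one_mul, mul_one, Unitary.mul_star_self_of_mem hT]

theorem norm_eq_one_of_eq_smul [Nontrivial H] (hU : U ∈ unitary (H →L[ℂ] H))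
    (hV : V ∈ unitary (H →L[ℂ] H)) {c : ℂ} (h : U = c • V) : ‖c‖ = 1 := by
  have hnorm := congrArg norm h
  rw [norm_smul, CStarRing.norm_of_mem_unitary hU, CStarRing.norm_of_mem_unitary hV,
    mul_one] at hnorm
  exact hnorm.symm

theorem IsIrreducible.exists_eq_smul_shiftImplementer [Nontrivial H] (hπ : IsIrreducible π)
    (hT : Implements π (translation 1) T)
    (hV : Implements (siteRep π) (siteRotation (Set.Ici 1) θ) V) :
    ∃ c : Circle, ∀ U, Implements (siteRep π) (siteRotation (Set.Ici 1) θ) U →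
      U = (c : ℂ) • shiftImplementer π T θ U := by
  obtain ⟨c, hc⟩ := hV.eq_smul (isIrreducible_siteRep hπ) (hT.shiftImplementer hV)
  have hc1 := norm_eq_one_of_eq_smul hV.1 (hT.shiftImplementer hV).1 hc
  refine ⟨⟨c, mem_sphere_zero_iff_norm.mpr hc1⟩, fun U hU => ?_⟩
  obtain ⟨d, rfl⟩ := hU.eq_smul (isIrreducible_siteRep hπ) hV
  have hlin : shiftImplementer π T θ (d • V) = d • shiftImplementer π T θ V := by
    simp only [shiftImplementer, mul_smul_comm, smul_mul_assoc]
  rw [hlin, smul_comm]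
  exact congrArg (d • ·) hc

theorem IsIrreducible.exists_addChar [Nontrivial H] (hπ : IsIrreducible π)
    (hT : Implements π (translation 1) T)
    (hex : ∀ θ, ∃ V, Implements (siteRep π) (siteRotation (Set.Ici 1) θ) V) :
    ∃ χ : AddChar ℝ Circle, χ (2 * Real.pi) = 1 ∧
      ∀ θ U, Implements (siteRep π) (siteRotation (Set.Ici 1) θ) U →
        U = (χ θ : ℂ) • shiftImplementer π T θ U := by
  choose χ hχ using fun θ => (hex θ).elim fun _ hV => hπ.exists_eq_smul_shiftImplementer hT hV
  have hone {θ : ℝ} (hθ : Circle.exp θ = 1) : χ θ = 1 := by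
    have h := hχ θ 1 (siteRotation_of_exp_eq_one _ hθ ▸ implements_id_one _)
    rw [shiftImplementer_one hT.1 hθ] at h
    exact Circle.ext (smul_left_injective ℂ one_ne_zero (by simpa using h.symm))
  have hmul (θ θ' : ℝ) : χ (θ + θ') = χ θ * χ θ' := by
    obtain ⟨U, hU⟩ := hex θ
    obtain ⟨V, hV⟩ := hex θ'
    have hUV := siteRotation_comp_siteRotation _ θ θ' ▸ hU.mul hV
    have hne := norm_ne_zero_iff.mp
      ((CStarRing.norm_of_mem_unitary (hT.shiftImplementer hUV).1).trans_ne one_ne_zero)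
    refine Circle.ext (smul_left_injective ℂ hne ?_)
    calc (χ (θ + θ') : ℂ) • shiftImplementer π T (θ + θ') (U * V) = U * V := (hχ _ _ hUV).symm
      _ = ((χ θ : ℂ) • shiftImplementer π T θ U) * ((χ θ' : ℂ) • shiftImplementer π T θ' V) := by
        rw [← hχ θ U hU, ← hχ θ' V hV]
      _ = ((χ θ * χ θ' : Circle) : ℂ) • shiftImplementer π T (θ + θ') (U * V) := by
        rw [smul_mul_smul_comm, shiftImplementer_mul hT hU, Circle.coe_mul]
  exact ⟨⟨χ, hone Circle.exp_zero, hmul⟩, hone Circle.exp_two_pi, hχ⟩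

end Character

section Counting

/-- The product of the phase matrices `phaseMatrix z` at the sites `1, …, n`. -/
noncomputable def phaseProd (z : ℂ) : ℕ → quasiLocal
  | 0 => 1
  | n + 1 => site 1 (phaseMatrix z) * translation 1 (phaseProd z n)

/-- The projection onto the spin configuration `s` at the sites `1, …, n`; the spin `s i` sits at
the site `i + 1`, and `1 : Fin 2` is the down spin. -/
noncomputable def configProj : (n : ℕ) → (Fin n → Fin 2) → quasiLocal
  | 0, _ => 1
  | n + 1, s => site 1 (Matrix.single (s 0) (s 0) 1) * translation 1 (configProj n (Fin.tail s))

/-- The number of down spins of a configuration. -/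
def downCount {n : ℕ} (s : Fin n → Fin 2) : ℕ :=
  ∑ i, (s i : ℕ)

theorem phaseProd_mem_unitary (z : Circle) (n : ℕ) : phaseProd z n ∈ unitary quasiLocal := by
  induction n with
  | zero => exact one_mem _
  | succ n ih => exact mul_mem (site_phaseMatrix_mem_unitary 1 z) (Unitary.map_mem _ ih)

theorem phaseProd_one (n : ℕ) : phaseProd 1 n = 1 := by
  induction n with
  | zero => rfl
  | succ n ih => rw [phaseProd, ih, phaseMatrix_one, map_one, map_one, one_mul]

theorem commute_site_configProj {j : ℤ} (hj : j ≤ 0) (Q : Matrix (Fin 2) (Fin 2) ℂ) (n : ℕ)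
    (s : Fin n → Fin 2) : Commute (site j Q) (configProj n s) := by
  induction n generalizing j with
  | zero => exact Commute.one_right _
  | succ n ih =>
    have htail := (ih (j := j - 1) (by omega) (Fin.tail s)).map (translation 1)
    rw [translation_site, add_sub_cancel] at htail
    exact (site_commute (by omega) _ _).mul_right htail

theorem isStarProjection_single (i : Fin 2) :
    IsStarProjection (Matrix.single i i 1 : Matrix (Fin 2) (Fin 2) ℂ) :=
  ⟨by rw [IsIdempotentElem, Matrix.single_mul_single_same, mul_one],
    by rw [IsSelfAdjoint, Matrix.star_eq_conjTranspose, Matrix.conjTranspose_single, star_one]⟩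

theorem isStarProjection_configProj (n : ℕ) (s : Fin n → Fin 2) :
    IsStarProjection (configProj n s) := by
  induction n with
  | zero => exact .one _
  | succ n ih =>
    have hcomm := (commute_site_configProj le_rfl (Matrix.single (s 0) (s 0) 1) n
      (Fin.tail s)).map (translation 1)
    rw [translation_site, add_zero] at hcomm
    exact ((isStarProjection_single (s 0)).map (site 1)).mul
      ((ih (Fin.tail s)).map (translation 1)) hcomm

theorem downCount_cons {n : ℕ} (i : Fin 2) (s : Fin n → Fin 2) :
    downCount (Fin.cons i s : Fin (n + 1) → Fin 2) = i + downCount s := by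
  simp only [downCount, Fin.sum_univ_succ, Fin.cons_zero, Fin.cons_succ]

theorem downCount_le {n : ℕ} (s : Fin n → Fin 2) : downCount s ≤ n := by
  simpa [downCount] using Finset.sum_le_card_nsmul Finset.univ (fun i => (s i : ℕ)) 1 fun i _ =>
    Nat.le_of_lt_succ (s i).isLt

theorem sum_smul_configProj_succ {n : ℕ} (f : (Fin (n + 1) → Fin 2) → ℂ) :
    ∑ s, f s • configProj (n + 1) s =
      ∑ i, site 1 (Matrix.single i i 1) *
        translation 1 (∑ s, f (Fin.cons i s) • configProj n s) := by
  rw [← (Fin.consEquiv fun _ => Fin 2).sum_comp, Fintype.sum_prod_type]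
  refine Finset.sum_congr rfl fun i _ => ?_
  rw [map_sum, Finset.mul_sum]
  refine Finset.sum_congr rfl fun s _ => ?_
  change f (Fin.cons i s) • configProj (n + 1) (Fin.cons i s) = _
  rw [configProj, Fin.cons_zero, Fin.tail_cons, map_smul, mul_smul_comm]

theorem site_phaseMatrix (j : ℤ) (z : ℂ) :
    site j (phaseMatrix z) =
      site j (Matrix.single 0 0 1) + z • site j (Matrix.single 1 1 1) := by
  rw [phaseMatrix_eq_single_add, map_add, map_smul]

theorem site_single_zero_add_site_single_one (j : ℤ) :
    site j (Matrix.single 0 0 1) + site j (Matrix.single 1 1 1) = 1 := by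
  simpa [phaseMatrix_one] using (site_phaseMatrix j 1).symm

theorem phaseProd_eq_sum (z : ℂ) (n : ℕ) :
    phaseProd z n = ∑ s, z ^ downCount s • configProj n s := by
  induction n with
  | zero => simp [phaseProd, configProj, downCount]
  | succ n ih =>
    simp only [sum_smul_configProj_succ, downCount_cons, pow_add, mul_smul, ← Finset.smul_sum,
      ← ih, map_smul, mul_smul_comm, Fin.sum_univ_two, phaseProd, site_phaseMatrix, add_mul,
      smul_mul_assoc]
    simp

theorem sum_configProj (n : ℕ) : ∑ s, configProj n s = 1 := by
  simpa [phaseProd_one] using (phaseProd_eq_sum 1 n).symm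

theorem sum_downCount_smul_configProj_succ (n : ℕ) :
    ∑ s, (downCount s : ℂ) • configProj (n + 1) s =
      site 1 (Matrix.single 1 1 1) + translation 1 (∑ s, (downCount s : ℂ) • configProj n s) := by
  simp only [sum_smul_configProj_succ, downCount_cons, Nat.cast_add, add_smul,
    Finset.sum_add_distrib, ← Finset.smul_sum, sum_configProj, map_add, Fin.sum_univ_two,
    Fin.val_zero, Fin.val_one, Nat.cast_zero, Nat.cast_one, zero_smul, one_smul, map_zero, map_one,
    mul_add, mul_one, mul_zero, zero_add]
  rw [← add_mul, site_single_zero_add_site_single_one, one_mul]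

variable {φ : State quasiLocal}

theorem map_sum_downCount_smul_configProj
    (htrans : ∀ (k : ℤ) (a : quasiLocal), φ (translation k a) = φ a) (n : ℕ) :
    φ (∑ s, (downCount s : ℂ) • configProj n s) = n * φ (site 1 (Matrix.single 1 1 1)) := by
  induction n with
  | zero => simp [downCount]
  | succ n ih =>
    rw [sum_downCount_smul_configProj_succ, map_add, htrans, ih]
    push_cast
    ring

theorem State.nonneg_of_isStarProjection {A : Type*} [CStarAlgebra A] (φ : State A) {p : A}
    (hp : IsStarProjection p) : 0 ≤ φ p := by
  have hφ := φ.nonneg p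
  rwa [hp.isSelfAdjoint.star_eq, hp.isIdempotentElem.eq] at hφ

variable (φ) in
/-- The law, in the state `φ`, of the number of down spins at the sites `1, …, n`. -/
noncomputable def countLaw (n : ℕ) : Measure ℝ :=
  ∑ s, ENNReal.ofReal (φ (configProj n s)).re • Measure.dirac (downCount s : ℝ)

variable (φ) in
theorem integral_countLaw {E : Type*} [NormedAddCommGroup E] [NormedSpace ℂ E] [CompleteSpace E]
    (n : ℕ) (f : ℝ → E) :
    ∫ x, f x ∂countLaw φ n = ∑ s, φ (configProj n s) • f (downCount s) := by
  rw [countLaw, integral_finsetSum_measure]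
  · refine Finset.sum_congr rfl fun s _ => ?_
    have hs := φ.nonneg_of_isStarProjection (isStarProjection_configProj n s)
    rw [integral_smul_measure, integral_dirac, ENNReal.toReal_ofReal (Complex.nonneg_iff.mp hs).1,
      ← Complex.coe_smul, ← Complex.eq_re_of_ofReal_le hs]
  · exact fun s _ => (integrable_dirac (by simp)).smul_measure ENNReal.ofReal_ne_top

theorem isProbabilityMeasure_countLaw (φ : State quasiLocal) (n : ℕ) :
    IsProbabilityMeasure (countLaw φ n) := by
  have hsum : ∑ s, (φ (configProj n s)).re = 1 := by
    rw [← Complex.re_sum, ← map_sum, sum_configProj]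
    exact congrArg Complex.re φ.map_one
  refine ⟨?_⟩
  simp only [countLaw, Measure.coe_finsetSum, Finset.sum_apply, Measure.smul_apply,
    measure_univ, smul_eq_mul, mul_one]
  rw [← ENNReal.ofReal_sum_of_nonneg, hsum, ENNReal.ofReal_one]
  exact fun s _ => (Complex.nonneg_iff.mp
    (φ.nonneg_of_isStarProjection (isStarProjection_configProj n s))).1

theorem ae_countLaw_abs_le (φ : State quasiLocal) (n : ℕ) : ∀ᵐ x : ℝ ∂countLaw φ n, |x| ≤ n := by
  rw [countLaw, ae_finsetSum_measure_iff]
  intro s _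
  refine Measure.ae_smul_measure ?_ _
  rw [ae_dirac_eq, Filter.eventually_pure, Nat.abs_cast, Nat.cast_le]
  exact downCount_le s

theorem charFun_countLaw (φ : State quasiLocal) (n : ℕ) (t : ℝ) :
    charFun (countLaw φ n) t = φ (phaseProd (Circle.exp t) n) := by
  rw [charFun_apply_real, integral_countLaw, phaseProd_eq_sum, map_sum]
  refine Finset.sum_congr rfl fun s _ => ?_
  rw [map_smul, smul_eq_mul, smul_eq_mul, mul_comm, Circle.coe_exp, ← Complex.exp_nat_mul]
  push_cast
  ring_nf

theorem integral_id_countLaw {φ : State quasiLocal}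
    (htrans : ∀ (k : ℤ) (a : quasiLocal), φ (translation k a) = φ a) (n : ℕ) :
    ∫ x, (x : ℂ) ∂countLaw φ n = n * φ (site 1 (Matrix.single 1 1 1)) := by
  rw [integral_countLaw, ← map_sum_downCount_smul_configProj htrans, map_sum]
  refine Finset.sum_congr rfl fun s _ => ?_
  rw [map_smul, smul_eq_mul, smul_eq_mul, mul_comm, Complex.ofReal_natCast]

end Counting

section CircleCharacters

variable {T : ℝ} [hT : Fact (0 < T)]

theorem fourierCoeff_comp_add_right {E : Type*} [NormedAddCommGroup E] [NormedSpace ℂ E]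
    (f : AddCircle T → E) (y : AddCircle T) (n : ℤ) :
    fourierCoeff (fun x => f (x + y)) n = fourier n y • fourierCoeff f n := by
  rw [fourierCoeff, fourierCoeff, ← integral_smul,
    ← integral_add_right_eq_self (fun x => fourier n y • fourier (-n) x • f x) y]
  refine integral_congr_ae (.of_forall fun x => ?_)
  have hphase : fourier n y * fourier (-n) (x + y) = fourier (-n) x := by
    simp only [fourier_apply, ← Circle.coe_mul, ← AddCircle.toCircle_add, smul_add, neg_smul]
    rw [add_comm (-(n • x)), add_neg_cancel_left]
  simp only [smul_smul, hphase]

theorem exists_fourierCoeff_ne_zero {f : C(AddCircle T, ℂ)} (hf : f ≠ 0) :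
    ∃ n, fourierCoeff f n ≠ 0 := by
  contrapose! hf
  ext x
  have hsum := has_pointwise_sum_fourier_series_of_summable (f := f)
    (by rw [funext hf]; exact summable_zero) x
  simp only [hf, zero_smul] at hsum
  exact hsum.unique hasSum_zero

theorem exists_eq_fourier_of_continuous {χ : AddChar (AddCircle T) Circle} (hχ : Continuous χ) :
    ∃ n, ∀ x, (χ x : ℂ) = fourier n x := by
  have hne : (⟨fun x => (χ x : ℂ), by fun_prop⟩ : C(AddCircle T, ℂ)) ≠ 0 := fun h =>
    Circle.coe_ne_zero (χ 0) (DFunLike.congr_fun h 0)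
  obtain ⟨n, hn⟩ := exists_fourierCoeff_ne_zero hne
  refine ⟨n, fun y => mul_right_cancel₀ hn ?_⟩
  have hadd := fourierCoeff_comp_add_right (fun x => (χ x : ℂ)) y n
  simp only [AddChar.map_add_eq_mul, Circle.coe_mul, mul_comm _ (χ y : ℂ)] at hadd
  rwa [fourierCoeff.const_mul] at hadd

theorem exists_eq_circleExp_of_continuousAt {χ : AddChar ℝ Circle} (h2π : χ (2 * Real.pi) = 1)
    (hχ : ContinuousAt χ 0) : ∃ m : ℤ, ∀ θ, χ θ = Circle.exp (m * θ) := by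
  have : Fact (0 < 2 * Real.pi) := ⟨Real.two_pi_pos⟩
  have hper : Function.Periodic χ (2 * Real.pi) := fun θ => by
    rw [AddChar.map_add_eq_mul, h2π, mul_one]
  have hcont : Continuous χ := continuous_of_continuousAt_zero χ.toAddMonoidHom hχ
  let χ' : AddChar (AddCircle (2 * Real.pi)) Circle :=
    { toFun := hper.lift
      map_zero_eq_one' := χ.map_zero_eq_one
      map_add_eq_mul' := fun x y => QuotientAddGroup.induction_on x fun _ =>
        QuotientAddGroup.induction_on y fun _ => χ.map_add_eq_mul _ _ }
  obtain ⟨m, hm⟩ := exists_eq_fourier_of_continuous (χ := χ') (continuous_coinduced_dom.mpr hcont)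
  refine ⟨m, fun θ => Circle.ext ((hm θ).trans ?_)⟩
  rw [fourier_coe_apply, Circle.coe_exp]
  congr 1
  push_cast
  field_simp [Complex.ofReal_ne_zero.mpr Real.pi_ne_zero]

end CircleCharacters

section Drift

theorem measureReal_lt_abs_le_of_charFun {μ : Measure ℝ} [IsProbabilityMeasure μ] {δ η : ℝ}
    (hδ : 0 < δ) (hη : ∀ t, |t| ≤ δ → ‖1 - charFun μ t‖ ≤ η) :
    μ.real {x | 2 / δ < |x|} ≤ 2 * η := by
  have hr : 2 * (2 / δ)⁻¹ = δ := by field_simp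
  have hint : ‖∫ t in -δ..δ, 1 - charFun μ t‖ ≤ η * |δ - -δ| := by
    refine intervalIntegral.norm_integral_le_of_norm_le_const fun t ht => hη t (abs_le.mpr ?_)
    rw [Set.uIoc_of_le (by linarith)] at ht
    exact ⟨ht.1.le, ht.2⟩
  rw [sub_neg_eq_add, abs_of_pos (add_pos hδ hδ)] at hint
  calc μ.real {x | 2 / δ < |x|}
      ≤ 2⁻¹ * (2 / δ) * ‖∫ t in -δ..δ, 1 - charFun μ t‖ := by
        simpa only [neg_mul, hr] using measureReal_abs_gt_le_integral_charFun (div_pos two_pos hδ)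
    _ ≤ 2⁻¹ * (2 / δ) * (η * (δ + δ)) := by gcongr
    _ = 2 * η := by field_simp; ring

theorem abs_integral_le_of_charFun {μ : Measure ℝ} [IsProbabilityMeasure μ] {M δ η : ℝ}
    (hδ : 0 < δ) (hM : ∀ᵐ x ∂μ, |x| ≤ M) (hη : ∀ t, |t| ≤ δ → ‖1 - charFun μ t‖ ≤ η) :
    |∫ x, x ∂μ| ≤ 2 / δ + M * (2 * η) := by
  have hM0 : 0 ≤ M := hM.exists.elim fun x hx => (abs_nonneg x).trans hx
  have hS : MeasurableSet {x : ℝ | 2 / δ < |x|} := measurableSet_lt measurable_const measurable_abs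
  have hle : ∀ᵐ x ∂μ, |x| ≤ 2 / δ + {x : ℝ | 2 / δ < |x|}.indicator (fun _ => M) x := by
    filter_upwards [hM] with x hx
    by_cases hxS : x ∈ {x : ℝ | 2 / δ < |x|}
    · rw [Set.indicator_of_mem hxS]
      have := div_pos two_pos hδ
      linarith
    · rw [Set.indicator_of_notMem hxS, add_zero]
      exact not_lt.mp hxS
  have hind : Integrable ({x : ℝ | 2 / δ < |x|}.indicator fun _ => M) μ :=
    (integrable_const M).indicator hS
  calc |∫ x, x ∂μ| ≤ ∫ x, |x| ∂μ := abs_integral_le_integral_abs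
    _ ≤ ∫ x, 2 / δ + {x : ℝ | 2 / δ < |x|}.indicator (fun _ => M) x ∂μ :=
      integral_mono_of_nonneg (.of_forall fun x => abs_nonneg x)
        ((integrable_const _).add hind) hle
    _ = 2 / δ + M * μ.real {x | 2 / δ < |x|} := by
      rw [integral_add (integrable_const _) hind, integral_const, integral_indicator_const _ hS,
        probReal_univ, one_smul, smul_eq_mul, mul_comm]
    _ ≤ 2 / δ + M * (2 * η) := by
      gcongr
      exact measureReal_lt_abs_le_of_charFun hδ hη

theorem le_of_forall_nat_mul_le_add {a b C : ℝ} (h : ∀ n : ℕ, n * a ≤ C + n * b) : a ≤ b := by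
  by_contra! hab
  obtain ⟨n, hn⟩ := exists_nat_gt (C / (a - b))
  rw [div_lt_iff₀ (sub_pos.mpr hab)] at hn
  linarith [h n]

theorem eq_zero_of_tendsto_charFun {μ : ℕ → Measure ℝ} [∀ n, IsProbabilityMeasure (μ n)]
    {a M : ℝ} (hM : ∀ n : ℕ, ∀ᵐ x ∂μ n, |x| ≤ n * M)
    (hmean : ∀ n : ℕ, ∫ x, x ∂μ n = n * a)
    (hchar : ∀ η > 0, ∀ᶠ t in 𝓝 0, ∀ n, ‖1 - charFun (μ n) t‖ ≤ η) : a = 0 := by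
  have hle : ∀ η > 0, |a| ≤ M * (2 * η) := by
    intro η hη
    obtain ⟨ε, hε, hball⟩ := Metric.eventually_nhds_iff.mp (hchar η hη)
    refine le_of_forall_nat_mul_le_add (C := 2 / (ε / 2)) fun n => ?_
    have habs := abs_integral_le_of_charFun (half_pos hε) (hM n) fun t ht => hball (y := t)
      (by rw [Real.dist_0_eq_abs]; exact ht.trans_lt (half_lt_self hε)) n
    rwa [hmean, abs_mul, Nat.abs_cast, mul_assoc] at habs
  have hlim : Tendsto (fun η : ℝ => M * (2 * η)) (𝓝[>] 0) (𝓝 0) := by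
    refine Tendsto.mono_left ?_ nhdsWithin_le_nhds
    simpa using (show Continuous fun η : ℝ => M * (2 * η) by fun_prop).tendsto 0
  exact abs_nonpos_iff.mp (ge_of_tendsto hlim (eventually_mem_nhdsWithin.mono hle))

end Drift

section Density

theorem norm_apply_sub_self_le {H : Type*} [NormedAddCommGroup H] [InnerProductSpace ℂ H]
    [CompleteSpace H] {V : H →L[ℂ] H} (hV : V ∈ unitary (H →L[ℂ] H)) {x : H} (hx : V x = x)
    (y : H) : ‖V y - y‖ ≤ 2 * ‖x - y‖ := by
  calc ‖V y - y‖ = ‖(x - y) - V (x - y)‖ := by rw [map_sub, hx, sub_sub_sub_cancel_left]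
    _ ≤ ‖x - y‖ + ‖V (x - y)‖ := norm_sub_le _ _
    _ = 2 * ‖x - y‖ := by rw [ContinuousLinearMap.norm_map_of_mem_unitary hV, two_mul]

variable {φ : State quasiLocal}

theorem continuous_apply_phaseProd (φ : State quasiLocal) (n : ℕ) :
    Continuous fun t => φ (phaseProd (Circle.exp t) n) := by
  have := isProbabilityMeasure_countLaw φ n
  simpa only [← charFun_countLaw] using continuous_charFun (μ := countLaw φ n)

theorem State.exists_mem_Icc_of_isStarProjection {A : Type*} [CStarAlgebra A] (φ : State A)
    {p : A} (hp : IsStarProjection p) : ∃ r ∈ Set.Icc (0 : ℝ) 1, φ p = r := by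
  have hnonneg := φ.nonneg_of_isStarProjection hp
  have hle := φ.nonneg_of_isStarProjection hp.one_sub
  rw [map_sub, show φ.toLinearMap 1 = 1 from φ.map_one, sub_nonneg] at hle
  refine ⟨(φ p).re, ⟨?_, ?_⟩, Complex.eq_re_of_ofReal_le hnonneg⟩
  · exact (Complex.le_def.mp hnonneg).1
  · exact (Complex.le_def.mp hle).1

theorem re_density_eq_of_drift (htrans : ∀ (k : ℤ) (a : quasiLocal), φ (translation k a) = φ a)
    {m : ℝ} (hdrift : ∀ η > 0, ∀ᶠ t in 𝓝 0, ∀ n : ℕ,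
      ‖1 - (Circle.exp (-(m * t)) : ℂ) ^ n * φ (phaseProd (Circle.exp t) n)‖ ≤ η) :
    (φ (site 1 (Matrix.single 1 1 1))).re = m := by
  have hprob := isProbabilityMeasure_countLaw φ
  have hmeas (n : ℕ) : Measurable fun x : ℝ => x + -(n * m) := by fun_prop
  have hprob' (n : ℕ) : IsProbabilityMeasure ((countLaw φ n).map fun x => x + -(n * m)) :=
    Measure.isProbabilityMeasure_map (hmeas n).aemeasurable
  refine sub_eq_zero.mp (eq_zero_of_tendsto_charFun (M := 1 + |m|)
    (μ := fun n => (countLaw φ n).map fun x => x + -(n * m)) (fun n => ?_) (fun n => ?_)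
    fun η hη => (hdrift η hη).mono fun t ht n => ?_)
  · rw [ae_map_iff (hmeas n).aemeasurable (measurableSet_le measurable_abs measurable_const)]
    filter_upwards [ae_countLaw_abs_le φ n] with x hx
    calc |x + -(n * m)| ≤ |x| + |-(n * m)| := abs_add_le _ _
      _ ≤ n + n * |m| := by rw [abs_neg, abs_mul, Nat.abs_cast]; gcongr
      _ = n * (1 + |m|) := by ring
  · have hint : Integrable (fun x : ℝ => x) (countLaw φ n) :=
      .of_bound (by fun_prop) n (ae_countLaw_abs_le φ n)
    have hmean := congrArg Complex.re (integral_id_countLaw htrans n)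
    rw [integral_complex_ofReal, Complex.ofReal_re, ← Complex.ofReal_natCast,
      Complex.re_ofReal_mul] at hmean
    rw [integral_map (hmeas n).aemeasurable (by fun_prop), integral_add hint (integrable_const _),
      hmean, integral_const, probReal_univ, one_smul]
    ring
  · convert ht n using 3
    rw [charFun_map_add_const, charFun_countLaw, mul_comm]
    congr 1
    rw [Circle.coe_exp, ← Complex.exp_nat_mul]
    congr 1
    simp
    ring

variable {H : Type*} [NormedAddCommGroup H] [InnerProductSpace ℂ H] [CompleteSpace H]
  {π : quasiLocal →⋆ₐ[ℂ] (H →L[ℂ] H)} {T U : H →L[ℂ] H} {Ω : H}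

theorem apply_eq_pow_smul (hT : Implements π (translation 1) T) (hTΩ : T Ω = Ω) {θ : ℝ} {c : ℂ}
    (hU : U = c • shiftImplementer π T θ U) (n : ℕ) :
    U Ω = c ^ n • π (phaseProd (Circle.exp (-θ)) n) ((T ^ n) (U Ω)) := by
  have hstarΩ : star T Ω = Ω := by
    nth_rewrite 1 [← hTΩ]
    rw [← mul_apply_eq_comp, Unitary.star_mul_self_of_mem hT.mem_unitary, one_apply_eq_self]
  have hone : U Ω = c • π (site 1 (phaseMatrix (Circle.exp (-θ)))) (T (U Ω)) := by
    conv_lhs => rw [hU]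
    simp only [shiftImplementer, smul_apply, mul_apply_eq_comp, hstarΩ]
  induction n with
  | zero => simp [phaseProd]
  | succ n ih =>
    have hTπ (a : quasiLocal) (x : H) : T (π a x) = π (translation 1 a) (T x) :=
      DFunLike.congr_fun (hT.mul_apply a) x
    conv_lhs => rw [hone, ih]
    rw [map_smul, hTπ, map_smul, smul_smul, ← pow_succ', phaseProd, map_mul, mul_apply_eq_comp,
      pow_succ' T, mul_apply_eq_comp]

theorem norm_one_sub_pow_mul_le (hφ : ∀ a, inner ℂ Ω (π a Ω) = φ a) (hΩ : ‖Ω‖ = 1)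
    (hT : Implements π (translation 1) T) (hTΩ : T Ω = Ω) {θ : ℝ} {c : Circle}
    (hU : U = (c : ℂ) • shiftImplementer π T θ U) (n : ℕ) :
    ‖1 - (c : ℂ) ^ n * φ (phaseProd (Circle.exp (-θ)) n)‖ ≤ 2 * ‖U Ω - Ω‖ := by
  set V : H →L[ℂ] H := (c : ℂ) ^ n • (π (phaseProd (Circle.exp (-θ)) n) * T ^ n) with hV
  have hVmem : V ∈ unitary (H →L[ℂ] H) :=
    Unitary.smul_mem_of_mem (pow_mem (coe_circle_mem_unitary c) n)
      (mul_mem (Unitary.map_mem π (phaseProd_mem_unitary _ n)) (pow_mem hT.mem_unitary n))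
  have hTnΩ : (T ^ n) Ω = Ω := by
    rw [FunLike.coe_pow_eq_iterate]
    exact Function.iterate_fixed hTΩ n
  have hinner : 1 - (c : ℂ) ^ n * φ (phaseProd (Circle.exp (-θ)) n) =
      -inner ℂ Ω (V Ω - Ω) := by
    rw [inner_sub_right, inner_self_eq_norm_sq_to_K, hΩ, hV, smul_apply, mul_apply_eq_comp, hTnΩ,
      inner_smul_right, hφ]
    simp
  calc _ = ‖inner ℂ Ω (V Ω - Ω)‖ := by rw [hinner, norm_neg]
    _ ≤ ‖Ω‖ * ‖V Ω - Ω‖ := norm_inner_le_norm _ _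
    _ ≤ 2 * ‖U Ω - Ω‖ := by
      rw [hΩ, one_mul]
      exact norm_apply_sub_self_le hVmem (apply_eq_pow_smul hT hTΩ hU n).symm Ω

theorem continuousAt_of_tendsto_mul {χ : AddChar ℝ Circle} {f : ℝ → ℂ} (hf : ContinuousAt f 0)
    (hf0 : f 0 = 1) (hχf : Tendsto (fun θ => χ θ * f θ) (𝓝 0) (𝓝 1)) : ContinuousAt χ 0 := by
  have hdiv := hχf.div (hf0 ▸ hf.tendsto) one_ne_zero
  rw [div_one] at hdiv
  rw [ContinuousAt, AddChar.map_zero_eq_one]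
  refine tendsto_subtype_rng.mpr (hdiv.congr' ?_)
  filter_upwards [hf.eventually_ne (hf0 ▸ one_ne_zero)] with θ hθ
  exact mul_div_cancel_right₀ _ hθ

theorem IsIrreducible.exists_int_drift (hπ : IsIrreducible π) (hφ : ∀ a, inner ℂ Ω (π a Ω) = φ a)
    (hΩ : ‖Ω‖ = 1) (hT : Implements π (translation 1) T) (hTΩ : T Ω = Ω) {U : ℝ → H →L[ℂ] H}
    (hU : ∀ᶠ θ in 𝓝 0, Implements (siteRep π) (siteRotation (Set.Ici 1) θ) (U θ))
    (hUΩ : Tendsto (U · Ω) (𝓝 0) (𝓝 Ω)) :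
    ∃ m : ℤ, ∀ η > 0, ∀ᶠ t in 𝓝 0, ∀ n : ℕ,
      ‖1 - (Circle.exp (-(m * t)) : ℂ) ^ n * φ (phaseProd (Circle.exp t) n)‖ ≤ η := by
  have : Nontrivial H := ⟨Ω, 0, norm_ne_zero_iff.mp (hΩ ▸ one_ne_zero)⟩
  obtain ⟨χ, hχ2π, hχU⟩ := hπ.exists_addChar hT (exists_implements_of_eventually hU)
  have hbound : ∀ η > 0, ∀ᶠ θ in 𝓝 0, ∀ n : ℕ,
      ‖1 - (χ θ : ℂ) ^ n * φ (phaseProd (Circle.exp (-θ)) n)‖ ≤ η := by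
    have hlim : Tendsto (fun θ => 2 * ‖U θ Ω - Ω‖) (𝓝 0) (𝓝 0) := by
      simpa using (hUΩ.sub_const Ω).norm.const_mul 2
    intro η hη
    filter_upwards [hU, hlim.eventually_le_const hη] with θ hθ hle n
    exact (norm_one_sub_pow_mul_le hφ hΩ hT hTΩ (hχU θ _ hθ) n).trans hle
  have hχ0 : ContinuousAt χ 0 := by
    have hf := (continuous_apply_phaseProd φ 1).comp continuous_neg
    refine continuousAt_of_tendsto_mul hf.continuousAt ?_ ?_
    · rw [Function.comp_apply, neg_zero, Circle.exp_zero, Circle.coe_one, phaseProd_one]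
      exact φ.map_one
    · rw [Metric.tendsto_nhds]
      intro η hη
      filter_upwards [hbound (η / 2) (half_pos hη)] with θ hθ
      rw [dist_comm, dist_eq_norm, ← pow_one (χ θ : ℂ)]
      exact (hθ 1).trans_lt (half_lt_self hη)
  obtain ⟨m, hm⟩ := exists_eq_circleExp_of_continuousAt hχ2π hχ0
  refine ⟨m, fun η hη => ?_⟩
  have hneg := (continuous_neg.tendsto' (0 : ℝ) 0 neg_zero).eventually (hbound η hη)
  simpa only [hm, neg_neg, mul_neg] using hneg

theorem density_eq_zero_or_one (htrans : ∀ (k : ℤ) (a : quasiLocal), φ (translation k a) = φ a)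
    {m : ℤ} (hdrift : ∀ η > 0, ∀ᶠ t in 𝓝 0, ∀ n : ℕ,
      ‖1 - (Circle.exp (-(m * t)) : ℂ) ^ n * φ (phaseProd (Circle.exp t) n)‖ ≤ η) :
    φ (site 1 (Matrix.single 1 1 1)) = 0 ∨ φ (site 1 (Matrix.single 1 1 1)) = 1 := by
  have hre := re_density_eq_of_drift htrans hdrift
  obtain ⟨p, ⟨hp0, hp1⟩, hφp⟩ :=
    φ.exists_mem_Icc_of_isStarProjection ((isStarProjection_single 1).map (site 1))
  rw [hφp, Complex.ofReal_re] at hre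
  subst hre
  rw [hφp]
  norm_cast at hp0 hp1 ⊢
  omega

end Density

section Products

variable {A : Type*} [CStarAlgebra A] {e : A}

theorem State.inner_gnsRep_gnsRep (φ : State A) (a b : A) :
    inner ℂ (φ.gnsRep a φ.cyclicVector) (φ.gnsRep b φ.cyclicVector) = φ (star a * b) :=
  (inner_map_apply_map_apply (.ofClass φ.gnsRep) a b _ _).trans (φ.inner_cyclicVector_gnsRep _)

theorem State.gnsRep_apply_cyclicVector_of_map_eq_one {φ : State A}
    (he : IsStarProjection e) (hφ : φ e = 1) : φ.gnsRep e φ.cyclicVector = φ.cyclicVector := by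
  have hzero : inner ℂ (φ.gnsRep (1 - e) φ.cyclicVector) (φ.gnsRep (1 - e) φ.cyclicVector) =
      (0 : ℂ) := by
    rw [φ.inner_gnsRep_gnsRep, he.one_sub.isSelfAdjoint.star_eq, he.one_sub.isIdempotentElem.eq,
      map_sub, hφ, sub_eq_zero]
    exact φ.map_one
  rw [inner_self_eq_zero, map_sub, _root_.map_one, sub_apply, one_apply_eq_self,
    sub_eq_zero] at hzero
  exact hzero.symm

theorem State.map_mul_right_of_map_eq_one {φ : State A} (he : IsStarProjection e) (hφ : φ e = 1)
    (a : A) : φ (a * e) = φ a := by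
  rw [← φ.inner_cyclicVector_gnsRep, ← φ.inner_cyclicVector_gnsRep, map_mul, mul_apply_eq_comp,
    State.gnsRep_apply_cyclicVector_of_map_eq_one he hφ]

theorem State.map_mul_left_of_map_eq_one {φ : State A} (he : IsStarProjection e) (hφ : φ e = 1)
    (a : A) : φ (e * a) = φ a := by
  have hinner := φ.inner_gnsRep_gnsRep e a
  rwa [he.isSelfAdjoint.star_eq, State.gnsRep_apply_cyclicVector_of_map_eq_one he hφ,
    φ.inner_cyclicVector_gnsRep, eq_comm] at hinner

variable {φ : State quasiLocal} {i : Fin 2}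

theorem map_site_mul {j : ℤ} (hj : φ (site j (Matrix.single i i 1)) = 1)
    (Q : Matrix (Fin 2) (Fin 2) ℂ) {R : quasiLocal}
    (hR : Commute R (site j (Matrix.single i i 1))) : φ (site j Q * R) = Q i i * φ R := by
  have he : IsStarProjection (site j (Matrix.single i i 1)) := (isStarProjection_single i).map _
  have hcorner : (Matrix.single i i 1 * Q * Matrix.single i i 1 : Matrix (Fin 2) (Fin 2) ℂ) =
      Q i i • Matrix.single i i 1 := by
    rw [Matrix.single_mul_mul_single, one_mul, mul_one, Matrix.smul_single, smul_eq_mul, mul_one]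
  have hcompress : site j (Matrix.single i i 1) * (site j Q * R * site j (Matrix.single i i 1)) =
      Q i i • (site j (Matrix.single i i 1) * R) := by
    rw [mul_assoc (site j Q), hR.eq, ← mul_assoc, ← mul_assoc, ← map_mul, ← map_mul, hcorner,
      map_smul, smul_mul_assoc]
  rw [← State.map_mul_right_of_map_eq_one he hj, ← State.map_mul_left_of_map_eq_one he hj,
    hcompress, map_smul, State.map_mul_left_of_map_eq_one he hj, smul_eq_mul]

theorem isProductState_of_single (h : ∀ j, φ (site j (Matrix.single i i 1)) = 1) :
    IsProductState φ := by
  intro l Q hl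
  induction l with
  | nil => exact φ.map_one
  | cons j l ih =>
    obtain ⟨hj, hl⟩ := List.nodup_cons.mp hl
    have hcomm : Commute (l.map fun k => site k (Q k)).prod (site j (Matrix.single i i 1)) := by
      refine Commute.list_prod_left _ _ fun x hx => ?_
      obtain ⟨k, hk, rfl⟩ := List.mem_map.mp hx
      exact site_commute (ne_of_mem_of_not_mem hk hj) _ _
    have hsite : φ (site j (Q j)) = Q j i i := by
      have hmul := map_site_mul (h j) (Q j) (Commute.one_left _)
      rwa [mul_one, show φ.toLinearMap 1 = 1 from φ.map_one, mul_one] at hmul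
    rw [List.map_cons, List.prod_cons, List.map_cons, List.prod_cons, map_site_mul (h j) _ hcomm,
      ih hl, hsite]

theorem isProductState_of_density
    (htrans : ∀ (k : ℤ) (a : quasiLocal), φ (translation k a) = φ a)
    (h : φ (site 1 (Matrix.single 1 1 1)) = 0 ∨ φ (site 1 (Matrix.single 1 1 1)) = 1) :
    IsProductState φ := by
  have hsite (j : ℤ) (Q : Matrix (Fin 2) (Fin 2) ℂ) : φ (site j Q) = φ (site 1 Q) := by
    rw [← htrans (j - 1) (site 1 Q), translation_site, sub_add_cancel]
  rcases h with hup | hdown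
  · refine isProductState_of_single (i := 0) fun j => ?_
    rw [hsite, eq_sub_of_add_eq (site_single_zero_add_site_single_one 1), map_sub, hup, sub_zero]
    exact φ.map_one
  · exact isProductState_of_single (i := 1) fun j => (hsite j _).trans hdown

end Products

end SpinChain

theorem mainTheorem6 (φ : SpinChain.State SpinChain.quasiLocal)
    (hpure : φ.IsPure)
    (htrans : ∀ (k : ℤ) (a : SpinChain.quasiLocal), φ (SpinChain.translation k a) = φ a)
    (hgauge : ∀ (θ : ℝ) (a : SpinChain.quasiLocal), φ (SpinChain.gauge θ a) = φ a)
    (htypeI : (φ.restrict SpinChain.rightAlgebra).IsTypeIRep) :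
    SpinChain.IsProductState φ := by
  obtain ⟨T, hT, hTΩ⟩ := φ.exists_implements_of_invariant _ (htrans 1)
  obtain ⟨U, hU, hUtendsto⟩ := hpure.exists_implements_siteRotation_tendsto hgauge htypeI
  obtain ⟨m, hm⟩ := hpure.isIrreducible_gnsRep.exists_int_drift φ.inner_cyclicVector_gnsRep
    φ.norm_cyclicVector hT hTΩ hU (hUtendsto _)
  exact SpinChain.isProductState_of_density htrans (SpinChain.density_eq_zero_or_one htrans hm)
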